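/- **Setting (prior-independent finite-horizon ski-rental).** Let $T\ge 1$ be the number of days, $B>1$ the stopping cost and $\delta\in(0,1]$. The weather is a sequence $X\in\{0,1\}^T$, where $X_i=1$ means that day $i$ is good. A deterministic algorithm $A=(A_1,\dots,A_T)$ consists of functions $A_i:\{0,1\}^i\to\{\text{stop},\text{continue}\}$; on day $i$ it observes $X_i$ and takes the decision $A_i(X_1,\dots,X_i)$. Stopping costs $B$ and ends all further costs; continuing costs $X_i$. Let $A(X)$ be the total cost on $X$, let $A(p)$ be its expectation when the days are good independently with probability $p$, and let $\mathrm{OPT}(p)=\min_A A(p)$ over all deterministic algorithms. A randomized algorithm is a probability distribution $\sigma$ over deterministic algorithms, and the prior-independent ratio is $$\beta=\min_{\sigma}\ \max_{p\in[\delta,1]}\ \frac{\mathbf E_{A\sim\sigma}[A(p)]}{\mathrm{OPT}(p)} .$$ For $\varepsilon>0$, $\sigma$ is an $\varepsilon$-approximate prior-independent optimal algorithm if $\max_{p\in[\delta,1]}\mathbf E_{A\sim\sigma}[A(p)]/\mathrm{OPT}(p)\le\beta+\varepsilon$. **Theorem.** There is a single program for the real random access machine (exact real arithmetic $+,-,\times,/$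 and comparisons, and arithmetic on natural numbers for indexing, at unit cost; no rounding of reals; only natural-number constants) which, on every input $(T,B,\delta,\varepsilon)$ with $T\ge1$, $B>1$, $0<\delta\le1$, $\varepsilon>0$, halts and outputs an explicit description of an $\varepsilon$-approximate prior-independent optimal randomized algorithm: a finite list of nonnegative weights with sum one and, for each weight, the decision table of a deterministic algorithm whose decision on day $i$ depends only on $i$, on the number of good days among the first $i-1$ days, and on the weather of day $i$. Its running time is $\tilde O(T^{12}\varepsilon^{-3})$ for $\varepsilon\le 1$. More precisely, there are absolute constants $C$ and $c$, independent of $T,B,\delta,\varepsilon$, such that for every input the number of steps is at most $$C\,T^{12}\,m^{3}\,\bigl(\log(2+T m)\bigr)^{c},\qquad m=\max\{1,1/\varepsilon\}.$$ -/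

import Mathlib

noncomputable section

/-! ### The finite-horizon ski-rental problem -/

namespace SkiRental

/-- A deterministic online algorithm for `T` days (day `i + 1` has index `i : Fin T`): on each day
it maps the weather observed so far, today included, to a decision. For the weather, `true` is a
good day and `false` a bad day; for the decision, `true` is "stop" and `false` is "continue". -/
abbrev DetAlg (T : ℕ) : Type := (i : Fin T) → (Fin (i.val + 1) → Bool) → Bool

variable {T : ℕ}

/-- The weather of the days up to and including day `i`. -/
def prefixOf (X : Fin T → Bool) (i : Fin T) : Fin (i.val + 1) → Bool :=
  fun j => X (Fin.castLE i.isLt j)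

/-- The decision that `A` prescribes on day `i` of the weather sequence `X`. -/
def decision (A : DetAlg T) (X : Fin T → Bool) (i : Fin T) : Bool := A i (prefixOf X i)

/-- The cost of `A` on `X`: the stopping cost `B` on the first day on which `A` stops (if there is
one), plus one for each good day up to which, that day included, `A` has always continued. -/
def cost (B : ℝ) (A : DetAlg T) (X : Fin T → Bool) : ℝ :=
  ∑ i : Fin T,
    ((if (∀ j : Fin T, j < i → decision A X j = false) ∧ decision A X i = true then B else 0) +
      (if (∀ j : Fin T, j ≤ i → decision A X j = false) ∧ X i = true then 1 else 0))

/-- The probability of the weather sequence `X` when each day is good with probability `p`,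
independently over days. -/
def seqProb (p : ℝ) (X : Fin T → Bool) : ℝ := ∏ i : Fin T, if X i = true then p else 1 - p

/-- The expected cost `A(p)` of a deterministic algorithm. -/
def expCost (B : ℝ) (A : DetAlg T) (p : ℝ) : ℝ :=
  ∑ X : Fin T → Bool, seqProb p X * cost B A X

/-- The expected cost of the Bayesian optimal algorithm, which knows `p`
(a minimum over a finite nonempty type). -/
def bayesOpt (T : ℕ) (B p : ℝ) : ℝ := ⨅ A : DetAlg T, expCost B A p

/-- `E_{A ∼ σ}[A(p)] / OPT_p(p)` for a randomized algorithm `σ`, given by the probabilities of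
the deterministic algorithms. -/
def ratio (B : ℝ) (σ : DetAlg T → ℝ) (p : ℝ) : ℝ :=
  (∑ A : DetAlg T, σ A * expCost B A p) / bayesOpt T B p

/-- The worst case of the ratio over `p ∈ [δ, 1]`. -/
def worstRatio (B δ : ℝ) (σ : DetAlg T → ℝ) : ℝ := ⨆ p : Set.Icc δ (1 : ℝ), ratio B σ p

/-- The prior-independent ratio: the least worst-case ratio of a randomized algorithm. -/
def priorIndependentRatio (T : ℕ) (B δ : ℝ) : ℝ :=
  ⨅ σ : stdSimplex ℝ (DetAlg T), worstRatio B δ (σ : DetAlg T → ℝ)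

/-- `σ` is a randomized algorithm whose worst-case ratio is within an additive `ε` of the
optimum over all randomized algorithms. -/
def IsApproxOptimal (B δ ε : ℝ) (σ : DetAlg T → ℝ) : Prop :=
  σ ∈ stdSimplex ℝ (DetAlg T) ∧ worstRatio B δ σ ≤ priorIndependentRatio T B δ + ε

/-- Information-symmetric deterministic algorithms: the decision on day `i` depends on the number
of good days among the earlier days and on the weather of day `i`. -/
abbrev InfoSymAlg (T : ℕ) : Type := (i : Fin T) → Fin (i.val + 1) → Bool → Bool

/-- The number of good days before the last day of a nonempty history. -/
def goodBefore {m : ℕ} (h : Fin (m + 1) → Bool) : Fin (m + 1) :=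
  ⟨(Finset.univ.filter fun j : Fin m => h j.castSucc = true).card,
    Nat.lt_succ_of_le ((Finset.card_le_univ _).trans_eq (Fintype.card_fin m))⟩

/-- An information-symmetric algorithm as a deterministic algorithm. -/
def InfoSymAlg.toDet (S : InfoSymAlg T) : DetAlg T :=
  fun i h => S i (goodBefore h) (h (Fin.last i.val))

end SkiRental

/-! ### A real random access machine

Programs are structured (assignments, sequencing, conditionals, loops). A machine has natural-number
and real registers and arrays of both kinds, with indirect addressing. The operations are
`+`, truncated `-` and `*` on natural numbers, the exact operations `+`, `-`, `*`, `/` on reals,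
the embedding of natural numbers into the reals, and comparisons; there is no rounding from reals to
natural numbers. The only constants that a program may contain are natural numbers. Every
operation, every memory access and every control step costs one unit of time. -/

namespace RealRAM

/-- Memory: registers and arrays. -/
structure State where
  nreg : ℕ → ℕ
  rreg : ℕ → ℝ
  narr : ℕ → ℕ → ℕ
  rarr : ℕ → ℕ → ℝ

/-- Natural-number expressions. -/
inductive NExp where
  | const (n : ℕ)
  | reg (v : ℕ)
  | arr (a : ℕ) (i : NExp)
  | add (x y : NExp)
  | sub (x y : NExp)
  | mul (x y : NExp)

/-- Real expressions. -/
inductive RExp where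
  | ofNat (x : NExp)
  | reg (v : ℕ)
  | arr (a : ℕ) (i : NExp)
  | add (x y : RExp)
  | sub (x y : RExp)
  | mul (x y : RExp)
  | div (x y : RExp)

/-- Tests. -/
inductive BExp where
  | nlt (x y : NExp)
  | rlt (x y : RExp)
  | not (b : BExp)
  | and (b c : BExp)

/-- The value of a natural-number expression. -/
def NExp.eval (s : State) : NExp → ℕ
  | .const n => n
  | .reg v => s.nreg v
  | .arr a i => s.narr a (i.eval s)
  | .add x y => x.eval s + y.eval s
  | .sub x y => x.eval s - y.eval s
  | .mul x y => x.eval s * y.eval s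

/-- The number of operations that evaluate a natural-number expression. -/
def NExp.time : NExp → ℕ
  | .const _ => 1
  | .reg _ => 1
  | .arr _ i => i.time + 1
  | .add x y => x.time + y.time + 1
  | .sub x y => x.time + y.time + 1
  | .mul x y => x.time + y.time + 1

/-- The value of a real expression. -/
def RExp.eval (s : State) : RExp → ℝ
  | .ofNat x => (x.eval s : ℝ)
  | .reg v => s.rreg v
  | .arr a i => s.rarr a (i.eval s)
  | .add x y => x.eval s + y.eval s
  | .sub x y => x.eval s - y.eval s
  | .mul x y => x.eval s * y.eval s
  | .div x y => x.eval s / y.eval s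

/-- The number of operations that evaluate a real expression. -/
def RExp.time : RExp → ℕ
  | .ofNat x => x.time + 1
  | .reg _ => 1
  | .arr _ i => i.time + 1
  | .add x y => x.time + y.time + 1
  | .sub x y => x.time + y.time + 1
  | .mul x y => x.time + y.time + 1
  | .div x y => x.time + y.time + 1

/-- A test succeeds. -/
def BExp.holds (s : State) : BExp → Prop
  | .nlt x y => x.eval s < y.eval s
  | .rlt x y => x.eval s < y.eval s
  | .not b => ¬ b.holds s
  | .and b c => b.holds s ∧ c.holds s

/-- The number of operations that evaluate a test. -/
def BExp.time : BExp → ℕ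
  | .nlt x y => x.time + y.time + 1
  | .rlt x y => x.time + y.time + 1
  | .not b => b.time + 1
  | .and b c => b.time + c.time + 1

/-- Programs. -/
inductive Program where
  | skip
  | setNReg (v : ℕ) (x : NExp)
  | setRReg (v : ℕ) (x : RExp)
  | setNArr (a : ℕ) (i x : NExp)
  | setRArr (a : ℕ) (i : NExp) (x : RExp)
  | seq (P Q : Program)
  | cond (b : BExp) (P Q : Program)
  | loop (b : BExp) (P : Program)

/-- `Exec P s t s'`: started in memory `s`, the program `P` halts after exactly `t` steps, with
memory `s'`. -/
inductive Exec : Program → State → ℕ → State → Prop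
  | skip (s : State) : Exec .skip s 1 s
  | setNReg (s : State) (v : ℕ) (x : NExp) :
      Exec (.setNReg v x) s (x.time + 1)
        { s with nreg := Function.update s.nreg v (x.eval s) }
  | setRReg (s : State) (v : ℕ) (x : RExp) :
      Exec (.setRReg v x) s (x.time + 1)
        { s with rreg := Function.update s.rreg v (x.eval s) }
  | setNArr (s : State) (a : ℕ) (i x : NExp) :
      Exec (.setNArr a i x) s (i.time + x.time + 1)
        { s with
          narr := Function.update s.narr a (Function.update (s.narr a) (i.eval s) (x.eval s)) }
  | setRArr (s : State) (a : ℕ) (i : NExp) (x : RExp) :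
      Exec (.setRArr a i x) s (i.time + x.time + 1)
        { s with
          rarr := Function.update s.rarr a (Function.update (s.rarr a) (i.eval s) (x.eval s)) }
  | seq {P Q : Program} {s s' s'' : State} {t u : ℕ} :
      Exec P s t s' → Exec Q s' u s'' → Exec (.seq P Q) s (t + u) s''
  | condTrue {b : BExp} {P Q : Program} {s s' : State} {t : ℕ} :
      b.holds s → Exec P s t s' → Exec (.cond b P Q) s (b.time + 1 + t) s'
  | condFalse {b : BExp} {P Q : Program} {s s' : State} {t : ℕ} :
      ¬ b.holds s → Exec Q s t s' → Exec (.cond b P Q) s (b.time + 1 + t) s'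
  | loopTrue {b : BExp} {P : Program} {s s' s'' : State} {t u : ℕ} :
      b.holds s → Exec P s t s' → Exec (.loop b P) s' u s'' →
        Exec (.loop b P) s (b.time + 1 + t + u) s''
  | loopFalse {b : BExp} {P : Program} {s : State} :
      ¬ b.holds s → Exec (.loop b P) s (b.time + 1) s

end RealRAM

namespace SkiRental

/-- The memory that holds the input `(T, B, δ, ε)`, everything else being zero. -/
def inputState (T : ℕ) (B δ ε : ℝ) : RealRAM.State where
  nreg := fun v => if v = 0 then T else 0
  rreg := fun v => if v = 0 then B else if v = 1 then δ else if v = 2 then ε else 0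
  narr := fun _ _ => 0
  rarr := fun _ _ => 0

/-- The `n`-th information-symmetric algorithm of an output, read off its decision table: it stops
on day `i`, after `k` good days among the earlier days and with weather `x`, if and only if
the cell at the position of `(n, i, k, x)` is nonzero. -/
def outputAlg (T : ℕ) (s : RealRAM.State) (n : ℕ) : InfoSymAlg T :=
  fun i k x => decide (s.narr 0 (((n * T + i.val) * T + k.val) * 2 + x.toNat) ≠ 0)

/-- The memory `s` holds an explicit description of the randomized algorithm `σ`: the number `N`
of entries (register `0`), nonnegative weights of sum one for the entries (real array `0`), and a
decision table for each entry (integer array `0`); `σ` plays each entry with the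
probability that is its weight. -/
def OutputsAlg (T : ℕ) (s : RealRAM.State) (σ : DetAlg T → ℝ) : Prop :=
  (∀ n < s.nreg 0, 0 ≤ s.rarr 0 n) ∧
    ∑ n ∈ Finset.range (s.nreg 0), s.rarr 0 n = 1 ∧
    ∀ A : DetAlg T,
      σ A = ∑ n ∈ Finset.range (s.nreg 0),
        if (outputAlg T s n).toDet = A then s.rarr 0 n else 0

end SkiRental

end

namespace SkiRental

/-! The problem is a zero-sum game between an algorithm and a parameter `p`, played by
multiplicative weights on a grid of values of `p`. Each round answers the current weights by a best
response, which is a Bayesian optimal algorithm for the prior obtained by dividing the weights by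
`OPT(p)`. The weight of each grid point is then multiplied by one plus `η` times the ratio incurred
there. The output is the uniform mixture of all responses. Weak duality suffices: against the
weights, the response is no worse than any rival mixture (`sum_responseTable_le`). Hence the regret
bound `sum_le_of_multiplicativeWeights` compares the average ratio at every grid point directly with
the worst ratio of the rival, without a minimax theorem.

The response is computable because the posterior depends only on the day and the number of good
days, and because stopping on a bad day never helps: one may wait for the next good day and pay at
most `B`. So backward induction over `O(T²)` states bounds every history-dependent algorithm from
below (`bayesValue_le`), and a table attains the value (`sum_tableCost_bayesTable`).

The estimates are free of `B` and `δ` for two reasons. Tables incur cost on good days only, so a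
factor `p` cancels from their ratios and leaves a denominator of at least one (`expCost_tableAlg`,
`one_le_optCost`). Moreover a response stops only if `B < T` (`lt_of_bayesTable`), so ratios are at
most `T²` and change at rate at most `4T⁴` in `p` (`tableRatio_le_add`). A grid of order `T⁴M`, a
learning rate of order `1/(T⁴M)` and order `T⁴M²L` rounds, with `L` logarithmic in the grid size,
then give total error `1/M ≤ ε` (`isApproxOptimal_uniform_roundTable`).

The program is verified in a Hoare logic with step bounds (`Runs`). A round costs `O((K+1)T³)`
steps, dominated by recomputing the posterior mass for each table cell, and the total is of order
`T¹¹m³` times a logarithm (`steps_le`). -/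

/-! ### Decomposition of the expected cost along the first day -/

/-- The algorithm that remains after the first day has had weather `x`. -/
def tailAlg {T : ℕ} (A : DetAlg (T + 1)) (x : Bool) : DetAlg T :=
  fun i h => A i.succ (Fin.cons x h : Fin (i.val + 1 + 1) → Bool)

theorem decision_cons_zero {T : ℕ} (A : DetAlg (T + 1)) (x : Bool) (X : Fin T → Bool) :
    decision A (Fin.cons x X : Fin (T + 1) → Bool) 0 = A 0 (fun _ => x) := by
  unfold decision
  congr 1
  funext j
  have : j = 0 := Subsingleton.elim (α := Fin 1) _ _
  subst this
  rfl

theorem decision_cons_succ {T : ℕ} (A : DetAlg (T + 1)) (x : Bool) (X : Fin T → Bool)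
    (i : Fin T) :
    decision A (Fin.cons x X : Fin (T + 1) → Bool) i.succ = decision (tailAlg A x) X i := by
  unfold decision tailAlg
  congr 1
  funext j
  refine Fin.cases (n := i.val + 1) ?_ (fun j => ?_) j <;> rfl

theorem cost_cons {T : ℕ} (B : ℝ) (A : DetAlg (T + 1)) (x : Bool) (X : Fin T → Bool) :
    cost B A (Fin.cons x X : Fin (T + 1) → Bool) =
      if A 0 (fun _ => x) = true then B
      else (if x = true then 1 else 0) + cost B (tailAlg A x) X := by
  unfold cost
  rw [Fin.sum_univ_succ]
  simp only [Fin.forall_fin_succ, decision_cons_zero, decision_cons_succ, Fin.cons_zero,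
    Fin.cons_succ, Fin.succ_lt_succ_iff, Fin.succ_le_succ_iff, Fin.succ_pos, Fin.zero_le,
    Fin.not_lt_zero, Fin.le_zero_iff, Fin.succ_ne_zero, false_imp_iff,
    forall_const, true_and]
  cases A 0 (fun _ => x) <;> cases x <;> simp

theorem seqProb_cons {T : ℕ} (p : ℝ) (x : Bool) (X : Fin T → Bool) :
    seqProb p (Fin.cons x X : Fin (T + 1) → Bool) =
      (if x = true then p else 1 - p) * seqProb p X := by
  simp [seqProb, Fin.prod_univ_succ]

theorem sum_weather_succ {T : ℕ} (f : (Fin (T + 1) → Bool) → ℝ) :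
    ∑ X, f X = ∑ X : Fin T → Bool, f (Fin.cons true X) + ∑ X : Fin T → Bool, f (Fin.cons false X) := by
  rw [← (Fin.consEquiv (fun _ : Fin (T + 1) => Bool)).sum_comp, Fintype.sum_prod_type,
    Fintype.sum_bool]
  rfl

theorem sum_seqProb (T : ℕ) (p : ℝ) : ∑ X : Fin T → Bool, seqProb p X = 1 := by
  induction T with
  | zero => simp [seqProb]
  | succ T ih =>
    rw [sum_weather_succ]
    simp only [seqProb_cons, ← Finset.mul_sum, ih]
    simp

theorem expCost_zero (B : ℝ) (A : DetAlg 0) (p : ℝ) : expCost B A p = 0 := by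
  simp [expCost, cost]

theorem expCost_succ {T : ℕ} (B : ℝ) (A : DetAlg (T + 1)) (p : ℝ) :
    expCost B A p =
      p * (if A 0 (fun _ => true) = true then B else 1 + expCost B (tailAlg A true) p) +
      (1 - p) * (if A 0 (fun _ => false) = true then B else expCost B (tailAlg A false) p) := by
  have h : ∀ b c : ℝ, ∀ f : (Fin T → Bool) → ℝ,
      ∑ X : Fin T → Bool, b * seqProb p X * (c + f X) = b * (c + ∑ X, seqProb p X * f X) := by
    intro b c f
    rw [mul_add, ← mul_one (b * c), ← sum_seqProb T p, Finset.mul_sum, Finset.mul_sum,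
      ← Finset.sum_add_distrib]
    exact Finset.sum_congr rfl fun X _ => by ring
  have h' : ∀ b c : ℝ, ∑ X : Fin T → Bool, b * seqProb p X * c = b * c := by
    intro b c
    simpa using h b c 0
  unfold expCost
  rw [sum_weather_succ]
  simp only [seqProb_cons, cost_cons]
  simp only [if_true, Bool.false_eq_true, if_false]
  congr 1
  · split_ifs
    · exact h' _ _
    · exact h _ _ _
  · split_ifs
    · exact h' _ _
    · simpa using h (1 - p) 0 (cost B (tailAlg A false))

/-! ### Tables that stop on good days only -/

/-- The algorithm that stops on good days only, as prescribed by a table indexed by the day and the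
number of earlier good days. -/
def tableAlg (T : ℕ) (S : ℕ → ℕ → Bool) : DetAlg T :=
  fun i h => h (Fin.last i.val) && S i.val (goodBefore h).val

/-- The table that remains after one day on which `x` (zero or one) good days were seen. -/
def shiftTable (S : ℕ → ℕ → Bool) (x : ℕ) : ℕ → ℕ → Bool := fun i g => S (i + 1) (g + x)

theorem goodBefore_cons {m : ℕ} (x : Bool) (h : Fin (m + 1) → Bool) :
    (goodBefore (Fin.cons x h : Fin (m + 1 + 1) → Bool)).val = (goodBefore h).val + x.toNat := by
  simp only [goodBefore, Finset.card_filter, Fin.sum_univ_succ]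
  rw [add_comm]
  congr 1
  cases x <;> rfl

theorem tailAlg_tableAlg (T : ℕ) (S : ℕ → ℕ → Bool) (x : Bool) :
    tailAlg (tableAlg (T + 1) S) x = tableAlg T (shiftTable S x.toNat) := by
  funext i h
  simp only [tailAlg, tableAlg, shiftTable]
  congr 1
  exact congrArg _ (goodBefore_cons x h)

theorem tableAlg_zero (T : ℕ) (S : ℕ → ℕ → Bool) (x : Bool) :
    tableAlg (T + 1) S 0 (fun _ => x) = (x && S 0 0) := by
  simp [tableAlg, goodBefore]

/-- The expected cost of a table over `n` days, divided by `p`. -/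
def tableCost (B p : ℝ) : ℕ → (ℕ → ℕ → Bool) → ℝ
  | 0, _ => 0
  | n + 1, S => (if S 0 0 = true then B else 1 + p * tableCost B p n (shiftTable S 1)) +
      (1 - p) * tableCost B p n (shiftTable S 0)

/-- Every payment of a table falls on a good day, so a factor `p` can be taken out. It cancels
against the same factor in the optimum, which keeps later bounds uniform as `p` approaches zero. -/
theorem expCost_tableAlg (B p : ℝ) (T : ℕ) (S : ℕ → ℕ → Bool) :
    expCost B (tableAlg T S) p = p * tableCost B p T S := by
  induction T generalizing S with
  | zero => simp [expCost_zero, tableCost]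
  | succ T ih =>
    rw [expCost_succ, tailAlg_tableAlg, tailAlg_tableAlg, ih, ih, tableAlg_zero, tableAlg_zero,
      tableCost]
    simp only [Bool.true_and, Bool.false_and, Bool.toNat_true, Bool.toNat_false]
    split_ifs <;> simp_all <;> ring

/-! ### Backward induction for the Bayesian problem -/

/-- The value of the Bayesian problem over `n` days with unnormalized prior `v` on the
points `p k`, computed by backward induction. -/
def bayesValue {ι : Type*} [Fintype ι] (B : ℝ) (p : ι → ℝ) : ℕ → (ι → ℝ) → ℝ
  | 0, _ => 0
  | n + 1, v => min (B * ∑ k, v k * p k) (∑ k, v k * p k + bayesValue B p n (fun k => v k * p k)) +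
      bayesValue B p n (fun k => v k * (1 - p k))

section Posterior
variable {ι : Type*} {p : ι → ℝ}

/-- The prior after `i` days of which `g` were good. -/
def posterior (p v : ι → ℝ) (i g : ℕ) : ι → ℝ := fun k => v k * p k ^ g * (1 - p k) ^ (i - g)

theorem posterior_good (v : ι → ℝ) (i g : ℕ) :
    (fun k => posterior p v i g k * p k) = posterior p v (i + 1) (g + 1) := by
  funext k
  simp only [posterior, Nat.add_sub_add_right]
  ring

theorem posterior_bad (v : ι → ℝ) (i g : ℕ) (h : g ≤ i) :
    (fun k => posterior p v i g k * (1 - p k)) = posterior p v (i + 1) g := by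
  funext k
  simp only [posterior, Nat.sub_add_comm h]
  ring

theorem posterior_nonneg (hp : ∀ k, 0 ≤ p k) (hp1 : ∀ k, p k ≤ 1) {v : ι → ℝ}
    (hv : ∀ k, 0 ≤ v k) (i g : ℕ) (k : ι) : 0 ≤ posterior p v i g k :=
  mul_nonneg (mul_nonneg (hv k) (pow_nonneg (hp k) _)) (pow_nonneg (sub_nonneg.2 (hp1 k)) _)

end Posterior

section Bayes
variable {ι : Type*} [Fintype ι] {B : ℝ} {p : ι → ℝ}

/-- The bound is the cost of stopping on the first good day. It shows that stopping on a bad day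
cannot beat waiting. -/
theorem bayesValue_le_mul (hB : 0 ≤ B) (n : ℕ) (v : ι → ℝ) (hv : ∀ k, 0 ≤ v k)
    (hp1 : ∀ k, p k ≤ 1) :
    bayesValue B p n v ≤ B * ∑ k, v k := by
  induction n generalizing v with
  | zero => exact mul_nonneg hB (Finset.sum_nonneg fun k _ => hv k)
  | succ n ih =>
    have h1 := ih (fun k => v k * (1 - p k)) fun k => mul_nonneg (hv k) (sub_nonneg.2 (hp1 k))
    have h2 : ∑ k, v k = ∑ k, v k * p k + ∑ k, v k * (1 - p k) := by
      rw [← Finset.sum_add_distrib]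
      exact Finset.sum_congr rfl fun k _ => by ring
    rw [h2, mul_add, bayesValue]
    exact add_le_add (min_le_left _ _) h1

/-- The bound is the cost of never stopping, at most one per day. -/
theorem bayesValue_le_days (n : ℕ) (v : ι → ℝ) (hv : ∀ k, 0 ≤ v k)
    (hp : ∀ k, 0 ≤ p k) (hp1 : ∀ k, p k ≤ 1) :
    bayesValue B p n v ≤ n * ∑ k, v k := by
  induction n generalizing v with
  | zero => simp [bayesValue]
  | succ n ih =>
    have h1 := ih (fun k => v k * (1 - p k)) fun k => mul_nonneg (hv k) (sub_nonneg.2 (hp1 k))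
    have h3 := ih (fun k => v k * p k) fun k => mul_nonneg (hv k) (hp k)
    have h2 : ∑ k, v k = ∑ k, v k * p k + ∑ k, v k * (1 - p k) := by
      rw [← Finset.sum_add_distrib]
      exact Finset.sum_congr rfl fun k _ => by ring
    have h4 : 0 ≤ ∑ k, v k * (1 - p k) :=
      Finset.sum_nonneg fun k _ => mul_nonneg (hv k) (sub_nonneg.2 (hp1 k))
    have h5 := min_le_right (B * ∑ k, v k * p k)
      (∑ k, v k * p k + bayesValue B p n (fun k => v k * p k))
    rw [h2, bayesValue]
    push_cast
    nlinarith

/-- The first day splits the prior into the unnormalized posteriors `v * p` and `v * (1 - p)`, and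
the induction hypothesis applies to the two tails separately. The algorithm may depend on the whole
history, so this is where restricting to information-symmetric tables is seen to lose nothing. -/
theorem bayesValue_le (hB : 0 ≤ B) (hp : ∀ k, 0 ≤ p k) (hp1 : ∀ k, p k ≤ 1) {T : ℕ}
    (A : DetAlg T) (v : ι → ℝ) (hv : ∀ k, 0 ≤ v k) :
    bayesValue B p T v ≤ ∑ k, v k * expCost B A (p k) := by
  induction T generalizing v with
  | zero => simp [bayesValue, expCost_zero]
  | succ T ih =>
    have hg : ∀ k, 0 ≤ v k * p k := fun k => mul_nonneg (hv k) (hp k)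
    have hb : ∀ k, 0 ≤ v k * (1 - p k) := fun k => mul_nonneg (hv k) (sub_nonneg.2 (hp1 k))
    have e : ∑ k, v k * expCost B A (p k) =
        (∑ k, v k * p k * (if A 0 (fun _ => true) = true then B
          else 1 + expCost B (tailAlg A true) (p k))) +
        ∑ k, v k * (1 - p k) * (if A 0 (fun _ => false) = true then B
          else expCost B (tailAlg A false) (p k)) := by
      rw [← Finset.sum_add_distrib]
      exact Finset.sum_congr rfl fun k _ => by rw [expCost_succ]; ring
    rw [e, bayesValue]
    refine add_le_add ?_ ?_
    · split_ifs
      · refine (min_le_left _ _).trans_eq ?_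
        rw [← Finset.sum_mul, mul_comm]
      · refine (min_le_right _ _).trans ?_
        simp only [mul_add, mul_one, Finset.sum_add_distrib]
        exact add_le_add le_rfl (ih _ _ hg)
    -- The recursion has no option to stop on a bad day; if `A` does so, waiting for the next good
    -- day is at least as cheap.
    · split_ifs
      · refine (bayesValue_le_mul hB T _ hb hp1).trans_eq ?_
        rw [← Finset.sum_mul, mul_comm]
      · exact ih _ _ hb

/-- The Bayesian optimal table for `T` days and prior `v`. -/
noncomputable def bayesTable (B : ℝ) (p v : ι → ℝ) (T : ℕ) : ℕ → ℕ → Bool := fun i g =>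
  decide (B * ∑ k, posterior p v i g k * p k < ∑ k, posterior p v i g k * p k +
    bayesValue B p (T - (i + 1)) (posterior p v (i + 1) (g + 1)))

theorem bayesValue_posterior_succ (n i g : ℕ) (v : ι → ℝ) (h : g ≤ i) :
    bayesValue B p (n + 1) (posterior p v i g) =
      min (B * ∑ k, posterior p v i g k * p k) (∑ k, posterior p v i g k * p k +
        bayesValue B p n (posterior p v (i + 1) (g + 1))) +
      bayesValue B p n (posterior p v (i + 1) g) := by
  rw [bayesValue, posterior_good, posterior_bad v i g h]

/-- A table after `i` days of which `g` were good. -/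
def dropTable (S : ℕ → ℕ → Bool) (i g : ℕ) : ℕ → ℕ → Bool := fun i' g' => S (i' + i) (g' + g)

theorem tableCost_dropTable_succ (S : ℕ → ℕ → Bool) (q : ℝ) (n i g : ℕ) :
    tableCost B q (n + 1) (dropTable S i g) =
      (if S i g = true then B else 1 + q * tableCost B q n (dropTable S (i + 1) (g + 1))) +
      (1 - q) * tableCost B q n (dropTable S (i + 1) g) := by
  have h1 : shiftTable (dropTable S i g) 1 = dropTable S (i + 1) (g + 1) := by
    funext a b; simp only [shiftTable, dropTable]; congr 1 <;> ring
  have h0 : shiftTable (dropTable S i g) 0 = dropTable S (i + 1) g := by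
    funext a b; simp only [shiftTable, dropTable]; congr 1; ring
  rw [tableCost, h1, h0]
  simp [dropTable]

/-- At each state the table selects the smaller argument of the minimum, and both arguments are
linear in the posterior, which is the same for all histories with equal `i` and `g`. Induction on
the remaining days adds up the branches. -/
theorem sum_tableCost_bayesTable (v : ι → ℝ) (T n i g : ℕ) (hT : n + i = T) (hg : g ≤ i) :
    ∑ k, posterior p v i g k * (p k * tableCost B (p k) n (dropTable (bayesTable B p v T) i g)) =
      bayesValue B p n (posterior p v i g) := by
  induction n generalizing i g with
  | zero => simp [tableCost, bayesValue]
  | succ n ih =>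
    rw [bayesValue_posterior_succ _ _ _ _ hg, ← ih (i + 1) (g + 1) (by omega) (by omega),
      ← ih (i + 1) g (by omega) (by omega)]
    have hn : T - (i + 1) = n := by omega
    have e := ih (i + 1) (g + 1) (by omega) (by omega)
    simp only [tableCost_dropTable_succ]
    by_cases hS : bayesTable B p v T i g = true
    · have hS' := hS
      rw [bayesTable, decide_eq_true_iff, hn, ← e] at hS'
      rw [min_eq_left hS'.le, Finset.mul_sum, ← Finset.sum_add_distrib]
      refine Finset.sum_congr rfl fun k _ => ?_
      rw [← posterior_bad v i g hg]
      simp only [hS, if_true]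
      ring
    · have hS' := hS
      rw [bayesTable, decide_eq_true_iff, hn, ← e, not_lt] at hS'
      rw [min_eq_right hS', ← Finset.sum_add_distrib, ← Finset.sum_add_distrib]
      refine Finset.sum_congr rfl fun k _ => ?_
      rw [← posterior_bad v i g hg, ← posterior_good v i g]
      simp only [hS]
      simp only [Bool.false_eq_true, if_false]
      ring

theorem sum_tableCost_bayesTable_self (v : ι → ℝ) (T : ℕ) :
    ∑ k, v k * (p k * tableCost B (p k) T (bayesTable B p v T)) = bayesValue B p T v := by
  have h := sum_tableCost_bayesTable (B := B) (p := p) v T T 0 0 rfl le_rfl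
  have e : posterior p v 0 0 = v := by funext k; simp [posterior]
  rwa [e] at h

/-- Continuing forever costs at most `T - i` times the current mass. As stopping requires a strict
gain, it cannot happen when `B ≥ T`. This removes `B` from all later bounds on tables. -/
theorem lt_of_bayesTable (hp : ∀ k, 0 ≤ p k) (hp1 : ∀ k, p k ≤ 1) {v : ι → ℝ}
    (hv : ∀ k, 0 ≤ v k) {T i g : ℕ} (hi : i < T) (h : bayesTable B p v T i g = true) :
    B < T := by
  rw [bayesTable, decide_eq_true_iff] at h
  have h1 := bayesValue_le_days (B := B) (p := p) (T - (i + 1)) _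
    (posterior_nonneg hp hp1 hv (i + 1) (g + 1)) hp hp1
  rw [← posterior_good] at h1 h
  have h0 : 0 ≤ ∑ k, posterior p v i g k * p k :=
    Finset.sum_nonneg fun k _ => mul_nonneg (posterior_nonneg hp hp1 hv i g k) (hp k)
  rw [Nat.cast_sub (by omega)] at h1
  push_cast at h1
  have hi0 : (0 : ℝ) ≤ i := Nat.cast_nonneg i
  by_contra hB
  push Not at hB
  nlinarith

end Bayes

/-! ### The optimum for known `p` -/

/-- The expected cost of the Bayesian optimal algorithm over `n` days, divided by `p`. -/
def optCost (B p : ℝ) : ℕ → ℝ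
  | 0 => 0
  | n + 1 => min B (1 + p * optCost B p n) + (1 - p) * optCost B p n

theorem bayesValue_unit (B q : ℝ) (hq : 0 ≤ q) (hq1 : q ≤ 1) (n : ℕ) (v : Unit → ℝ) (hv : 0 ≤ v ()) :
    bayesValue B (fun _ : Unit => q) n v = v () * q * optCost B q n := by
  induction n generalizing v with
  | zero => simp [bayesValue, optCost]
  | succ n ih =>
    rw [bayesValue, ih _ (mul_nonneg hv hq), ih _ (mul_nonneg hv (sub_nonneg.2 hq1)), optCost]
    simp only [Finset.univ_unique, Finset.sum_singleton, mul_add,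
      mul_min_of_nonneg _ _ (mul_nonneg hv hq)]
    congr 1
    · congr 1
      · exact mul_comm _ _
      · ring
    · ring

/-- This is the Bayesian problem for a prior with a single atom: the table gives the upper bound,
`bayesValue_le` the lower one. -/
theorem bayesOpt_eq (T : ℕ) {B p : ℝ} (hB : 0 ≤ B) (hp : 0 ≤ p) (hp1 : p ≤ 1) :
    bayesOpt T B p = p * optCost B p T := by
  have hv := bayesValue_unit B p hp hp1 T (fun _ => 1) zero_le_one
  apply le_antisymm
  · have h := sum_tableCost_bayesTable_self (B := B) (p := fun _ : Unit => p) (fun _ => 1) T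
    rw [hv] at h
    simp only [Finset.univ_unique, Finset.sum_singleton, one_mul] at h
    rw [← h, ← expCost_tableAlg]
    exact ciInf_le (Set.finite_range _).bddBelow _
  · refine le_ciInf fun A => ?_
    have h := bayesValue_le (B := B) (p := fun _ : Unit => p) hB (fun _ => hp) (fun _ => hp1) A
      (fun _ => 1) (fun _ => zero_le_one)
    rw [hv] at h
    simpa using h

theorem optCost_nonneg {B p : ℝ} (hB : 0 ≤ B) (hp : 0 ≤ p) (hp1 : p ≤ 1) (n : ℕ) :
    0 ≤ optCost B p n := by
  induction n with
  | zero => exact le_rfl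
  | succ n ih =>
    exact add_nonneg (le_min hB (by positivity)) (mul_nonneg (sub_nonneg.2 hp1) ih)

theorem one_le_optCost {B p : ℝ} (hB : 1 ≤ B) (hp : 0 ≤ p) (hp1 : p ≤ 1) {n : ℕ} (hn : 1 ≤ n) :
    1 ≤ optCost B p n := by
  obtain ⟨n, rfl⟩ := Nat.exists_eq_add_of_le' hn
  have h := optCost_nonneg (B := B) (by linarith) hp hp1 n
  have h1 : 1 ≤ min B (1 + p * optCost B p n) := le_min hB (by nlinarith)
  have h2 := mul_nonneg (sub_nonneg.2 hp1) h
  rw [optCost]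
  linarith

theorem optCost_le {B p : ℝ} (n : ℕ) : optCost B p n ≤ n := by
  induction n with
  | zero => simp [optCost]
  | succ n ih =>
    have := min_le_right B (1 + p * optCost B p n)
    rw [optCost]
    push_cast
    nlinarith


/-! ### Lipschitz dependence of ratios on `p` -/

section Lipschitz
variable {B p q : ℝ} {T : ℕ}

theorem tableCost_nonneg (hB : 0 ≤ B) (hp : 0 ≤ p) (hp1 : p ≤ 1) (n : ℕ) (S : ℕ → ℕ → Bool) :
    0 ≤ tableCost B p n S := by
  induction n generalizing S with
  | zero => exact le_rfl
  | succ n ih =>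
    have h1 := mul_nonneg hp (ih (shiftTable S 1))
    have h0 := mul_nonneg (sub_nonneg.2 hp1) (ih (shiftTable S 0))
    rw [tableCost]
    split_ifs <;> linarith

theorem tableCost_le (hT : 1 ≤ T) (hp : 0 ≤ p) (hp1 : p ≤ 1) (n : ℕ) (S : ℕ → ℕ → Bool)
    (hS : ∀ i < n, ∀ g, S i g = true → B ≤ T) :
    tableCost B p n S ≤ n * T := by
  have hT' : (1 : ℝ) ≤ T := by exact_mod_cast hT
  induction n generalizing S with
  | zero => simp [tableCost]
  | succ n ih =>
    have h1 := ih (shiftTable S 1) fun i hi g h => hS (i + 1) (by omega) _ h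
    have h0 := ih (shiftTable S 0) fun i hi g h => hS (i + 1) (by omega) _ h
    have h1' := mul_le_mul_of_nonneg_left h1 hp
    have h0' := mul_le_mul_of_nonneg_left h0 (sub_nonneg.2 hp1)
    have hn : (0 : ℝ) ≤ p * (n * T) := by positivity
    rw [tableCost]
    push_cast
    split_ifs with h
    · have := hS 0 (by omega) 0 h
      linarith
    · linarith

theorem abs_mul_sub_mul_le {p q a b d : ℝ} (hp : 0 ≤ p) (h : |a - b| ≤ d) (hb : 0 ≤ b) :
    |p * a - q * b| ≤ p * d + |p - q| * b := by
  have e : p * a - q * b = p * (a - b) + (p - q) * b := by ring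
  rw [e]
  refine (abs_add_le _ _).trans ?_
  rw [abs_mul, abs_mul, abs_of_nonneg hp, abs_of_nonneg hb]
  gcongr

/-- The coefficients `p` and `1 - p` sum to one, so the inductive error is passed on without growth.
Each day adds at most two terms `|p - q|` times a cost of at most `T²`. -/
theorem abs_tableCost_sub_le (hT : 1 ≤ T) (hB : 0 ≤ B) (hp : 0 ≤ p) (hp1 : p ≤ 1) (hq : 0 ≤ q)
    (hq1 : q ≤ 1) (n : ℕ) (hn : n ≤ T) (S : ℕ → ℕ → Bool)
    (hS : ∀ i < n, ∀ g, S i g = true → B ≤ T) :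
    |tableCost B p n S - tableCost B q n S| ≤ 2 * n * (T : ℝ) ^ 2 * |p - q| := by
  induction n generalizing S with
  | zero => simp [tableCost]
  | succ n ih =>
    have hS' : ∀ x, ∀ i < n, ∀ g, shiftTable S x i g = true → B ≤ T :=
      fun x i hi g h => hS (i + 1) (by omega) _ h
    have bd : ∀ x, tableCost B q n (shiftTable S x) ≤ (T : ℝ) ^ 2 := fun x =>
      (tableCost_le hT hq hq1 n _ (hS' x)).trans (by
        rw [pow_two]
        have : (n : ℝ) ≤ T := by exact_mod_cast (by omega : n ≤ T)
        gcongr)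
    have nn : ∀ x, 0 ≤ tableCost B q n (shiftTable S x) := fun x => tableCost_nonneg hB hq hq1 n _
    have l1 := abs_mul_sub_mul_le (q := q) hp (ih (by omega) _ (hS' 1)) (nn 1)
    have l0 := abs_mul_sub_mul_le (q := 1 - q) (sub_nonneg.2 hp1) (ih (by omega) _ (hS' 0)) (nn 0)
    have e : |1 - p - (1 - q)| = |p - q| := by rw [← abs_neg]; ring_nf
    rw [e] at l0
    have m1 := mul_le_mul_of_nonneg_left (bd 1) (abs_nonneg (p - q))
    have m0 := mul_le_mul_of_nonneg_left (bd 0) (abs_nonneg (p - q))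
    have hd : 0 ≤ p * (2 * n * (T : ℝ) ^ 2 * |p - q|) := by positivity
    have hd' : 0 ≤ (T : ℝ) ^ 2 * |p - q| := by positivity
    rw [tableCost, tableCost]
    push_cast
    split_ifs with h
    · rw [add_sub_add_left_eq_sub]
      linarith
    · have e2 : ∀ a b c d : ℝ, 1 + a + b - (1 + c + d) = (a - c) + (b - d) := by intros; ring
      rw [e2]
      refine (abs_add_le _ _).trans ?_
      linarith

theorem abs_optCost_sub_le (hB : 0 ≤ B) (hp : 0 ≤ p) (hp1 : p ≤ 1) (hq : 0 ≤ q)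
    (hq1 : q ≤ 1) (n : ℕ) (hn : n ≤ T) :
    |optCost B p n - optCost B q n| ≤ 2 * n * (T : ℝ) * |p - q| := by
  induction n with
  | zero => simp [optCost]
  | succ n ih =>
    have bd : optCost B q n ≤ T :=
      (optCost_le n).trans (by exact_mod_cast (by omega : n ≤ T))
    have nn := optCost_nonneg hB hq hq1 n
    have l1 := abs_mul_sub_mul_le (q := q) hp (ih (by omega)) nn
    have l0 := abs_mul_sub_mul_le (q := 1 - q) (sub_nonneg.2 hp1) (ih (by omega)) nn
    have e : |1 - p - (1 - q)| = |p - q| := by rw [← abs_neg]; ring_nf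
    rw [e] at l0
    have m1 := mul_le_mul_of_nonneg_left bd (abs_nonneg (p - q))
    have l2 : |min B (1 + p * optCost B p n) - min B (1 + q * optCost B q n)| ≤
        |p * optCost B p n - q * optCost B q n| := by
      refine (abs_min_sub_min_le_max _ _ _ _).trans ?_
      simp
    rw [optCost, optCost]
    push_cast
    rw [add_sub_add_comm]
    refine (abs_add_le _ _).trans ?_
    linarith

/-- The change of a quotient splits into the change of the numerator and that of the denominator.
Denominators of at least one can be dropped. -/
theorem div_le_div_add {a a' o o' d e A : ℝ} (ho : 1 ≤ o) (ho' : 1 ≤ o') (ha' : 0 ≤ a')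
    (hA : a' ≤ A) (h : |a - a'| ≤ d) (h' : |o - o'| ≤ e) : a / o ≤ a' / o' + (d + A * e) := by
  have hd : 0 ≤ d := (abs_nonneg _).trans h
  have he : 0 ≤ e := (abs_nonneg _).trans h'
  have e1 : a / o = a' / o' + ((a - a') / o + a' * (o' - o) / (o * o')) := by
    field_simp
    ring
  rw [e1]
  gcongr
  · refine (div_le_div_of_nonneg_right ((le_abs_self _).trans h) (by linarith)).trans ?_
    exact div_le_self hd ho
  · have h1 : a' * (o' - o) ≤ A * e := by
      refine (mul_le_mul_of_nonneg_left (?_ : o' - o ≤ e) ha').trans (by gcongr)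
      rw [abs_sub_comm] at h'
      exact (le_abs_self _).trans h'
    have h2 : 0 ≤ A * e := mul_nonneg (ha'.trans hA) he
    refine (div_le_div_of_nonneg_right h1 (by positivity)).trans ?_
    exact div_le_self h2 (by nlinarith)

/-- The ratio of a table at `p`. -/
noncomputable def tableRatio (B p : ℝ) (T : ℕ) (S : ℕ → ℕ → Bool) : ℝ :=
  tableCost B p T S / optCost B p T

theorem tableRatio_nonneg (hB : 0 ≤ B) (hp : 0 ≤ p) (hp1 : p ≤ 1) (S : ℕ → ℕ → Bool) :
    0 ≤ tableRatio B p T S :=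
  div_nonneg (tableCost_nonneg hB hp hp1 T S) (optCost_nonneg hB hp hp1 T)

theorem tableRatio_le (hT : 1 ≤ T) (hB : 1 ≤ B) (hp : 0 ≤ p) (hp1 : p ≤ 1) {S : ℕ → ℕ → Bool}
    (hS : ∀ i < T, ∀ g, S i g = true → B ≤ T) : tableRatio B p T S ≤ (T : ℝ) ^ 2 := by
  refine (div_le_self (tableCost_nonneg (by linarith) hp hp1 T S)
    (one_le_optCost hB hp hp1 hT)).trans ?_
  rw [pow_two]
  exact tableCost_le hT hp hp1 T S hS

theorem tableRatio_le_add (hT : 1 ≤ T) (hB : 1 ≤ B) (hp : 0 ≤ p) (hp1 : p ≤ 1) (hq : 0 ≤ q)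
    (hq1 : q ≤ 1) {S : ℕ → ℕ → Bool} (hS : ∀ i < T, ∀ g, S i g = true → B ≤ T) :
    tableRatio B p T S ≤ tableRatio B q T S + 4 * (T : ℝ) ^ 4 * |p - q| := by
  have hT' : (1 : ℝ) ≤ T := by exact_mod_cast hT
  have hB0 : 0 ≤ B := by linarith
  have h := div_le_div_add (one_le_optCost hB hp hp1 hT) (one_le_optCost hB hq hq1 hT)
    (tableCost_nonneg hB0 hq hq1 T S) (tableCost_le hT hq hq1 T S hS)
    (abs_tableCost_sub_le hT hB0 hp hp1 hq hq1 T le_rfl S hS)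
    (abs_optCost_sub_le hB0 hp hp1 hq hq1 T le_rfl)
  refine h.trans ?_
  -- The numerator contributes `2T³`, the denominator `2T⁴`; raising the cube to a fourth power
  -- gives the constant `4T⁴`.
  have h3 : (T : ℝ) ^ 3 * |p - q| ≤ (T : ℝ) ^ 4 * |p - q| := by
    gcongr
    · norm_num
  have e : 2 * (T : ℝ) * (T : ℝ) ^ 2 * |p - q| + T * T * (2 * T * T * |p - q|) =
      2 * ((T : ℝ) ^ 3 * |p - q|) + 2 * ((T : ℝ) ^ 4 * |p - q|) := by ring
  unfold tableRatio
  rw [e]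
  linarith

end Lipschitz

/-! ### The multiplicative weights method -/

theorem exp_sub_sq_le {y : ℝ} (hy : 0 ≤ y) : Real.exp (y - y ^ 2) ≤ 1 + y := by
  have h : 0 < 1 + y := by linarith
  rw [← Real.le_log_iff_exp_le h]
  refine le_trans ?_ (Real.one_sub_inv_le_log_of_pos h)
  have e : 1 - (1 + y)⁻¹ = y / (1 + y) := by field_simp; ring
  rw [e, le_div_iff₀ h]
  nlinarith [pow_nonneg hy 3]

/-- The total weight is the potential. It grows by at most `exp (η * β)` per round, while it
dominates the weight of each single `k`, which grows by at least `exp (r * η - (r * η) ^ 2)`.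
Comparing exponents after `N` rounds and dividing by `η` gives the regret bound. -/
theorem sum_le_of_multiplicativeWeights {ι : Type*} [Fintype ι] {W r : ℕ → ι → ℝ} {η ρ β : ℝ}
    (hη : 0 < η) (h0 : ∀ k, W 0 k = 1) (hW : ∀ t k, W (t + 1) k = W t k * (1 + r t k * η))
    (hr : ∀ t k, 0 ≤ r t k) (hρ : ∀ t k, r t k ≤ ρ)
    (hβ : ∀ t, ∑ k, W t k * r t k ≤ β * ∑ k, W t k) {L : ℕ} (hL : Fintype.card ι ≤ 2 ^ L)
    (N : ℕ) (k : ι) :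
    ∑ t ∈ Finset.range N, r t k ≤ N * β + L / η + N * (η * ρ ^ 2) := by
  have hpos : ∀ t k, 0 < W t k := by
    intro t k
    induction t with
    | zero => rw [h0]; exact one_pos
    | succ t ih => rw [hW]; have := hr t k; positivity
  have up : ∀ t : ℕ, ∑ k, W t k ≤ Fintype.card ι * Real.exp (t * (η * β)) := by
    intro t
    induction t with
    | zero => simp [h0]
    | succ t ih =>
      have e : ∑ k, W (t + 1) k = ∑ k, W t k + η * ∑ k, W t k * r t k := by
        rw [Finset.mul_sum, ← Finset.sum_add_distrib]
        exact Finset.sum_congr rfl fun k _ => by rw [hW]; ring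
      have hs : 0 ≤ ∑ k, W t k := Finset.sum_nonneg fun k _ => (hpos t k).le
      calc ∑ k, W (t + 1) k ≤ (∑ k, W t k) * (η * β + 1) := by
            rw [e]
            nlinarith [mul_le_mul_of_nonneg_left (hβ t) hη.le]
        _ ≤ (∑ k, W t k) * Real.exp (η * β) :=
            mul_le_mul_of_nonneg_left (Real.add_one_le_exp _) hs
        _ ≤ Fintype.card ι * Real.exp (t * (η * β)) * Real.exp (η * β) :=
            mul_le_mul_of_nonneg_right ih (Real.exp_pos _).le
        _ = _ := by
            rw [mul_assoc, ← Real.exp_add]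
            push_cast
            ring_nf
  have low : Real.exp (∑ t ∈ Finset.range N, (r t k * η - (r t k * η) ^ 2)) ≤ W N k := by
    induction N with
    | zero => simp [h0]
    | succ N ih =>
      rw [Finset.sum_range_succ, Real.exp_add, hW]
      exact mul_le_mul ih (exp_sub_sq_le (mul_nonneg (hr N k) hη.le)) (Real.exp_pos _).le
        (hpos N k).le
  -- Since `2 ≤ exp 1`, the integer binary logarithm `L` may replace the natural logarithm of the
  -- number of points; the machine can compute `L` exactly.
  have hL' : (Fintype.card ι : ℝ) ≤ Real.exp L := by
    have h2 : (2 : ℝ) ≤ Real.exp 1 := by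
      have := Real.add_one_le_exp (1 : ℝ)
      linarith
    calc (Fintype.card ι : ℝ) ≤ 2 ^ L := by exact_mod_cast hL
      _ ≤ Real.exp 1 ^ L := by gcongr
      _ = Real.exp L := by rw [← Real.exp_nat_mul, mul_one]
  have key : Real.exp (∑ t ∈ Finset.range N, (r t k * η - (r t k * η) ^ 2)) ≤
      Real.exp (L + N * (η * β)) := by
    rw [Real.exp_add]
    refine low.trans ((Finset.single_le_sum (fun k _ => (hpos N k).le) (Finset.mem_univ k)).trans
      ((up N).trans ?_))
    gcongr
  rw [Real.exp_le_exp, Finset.sum_sub_distrib, ← Finset.sum_mul] at key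
  have sq : ∑ t ∈ Finset.range N, (r t k * η) ^ 2 ≤ N * (η * ρ) ^ 2 := by
    refine (Finset.sum_le_card_nsmul _ _ ((η * ρ) ^ 2) fun t _ => ?_).trans_eq (by simp)
    rw [mul_comm η]
    have := hr t k
    have := hρ t k
    gcongr
  have e : N * β + L / η + N * (η * ρ ^ 2) = (L + N * (η * β) + N * (η * ρ) ^ 2) / η := by
    field_simp
    ring
  rw [e, le_div_iff₀ hη]
  linarith

/-! ### The grid of parameters -/

/-- The `k`-th of the `K + 1` equidistant points of `[δ, 1]`. -/
noncomputable def gridPoint (δ : ℝ) (K k : ℕ) : ℝ := δ + (1 - δ) * (k / K)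

section Grid
variable {δ : ℝ} {K : ℕ}

theorem gridPoint_pos (hδ : 0 < δ) (hδ1 : δ ≤ 1) (k : ℕ) : 0 < gridPoint δ K k := by
  have := sub_nonneg.2 hδ1
  unfold gridPoint
  positivity

theorem le_gridPoint (hδ1 : δ ≤ 1) (k : ℕ) : δ ≤ gridPoint δ K k := by
  have h : 0 ≤ (1 - δ) * (k / K : ℝ) := mul_nonneg (sub_nonneg.2 hδ1) (by positivity)
  unfold gridPoint
  linarith

theorem gridPoint_le_one (hδ1 : δ ≤ 1) {k : ℕ} (hk : k ≤ K) : gridPoint δ K k ≤ 1 := by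
  have h : (k / K : ℝ) ≤ 1 := div_le_one_of_le₀ (by exact_mod_cast hk) (by positivity)
  have := mul_le_mul_of_nonneg_left h (sub_nonneg.2 hδ1)
  unfold gridPoint
  linarith

theorem exists_gridPoint_near (hK : 0 < K) (hδ : 0 < δ) {p : ℝ} (hp : δ ≤ p) (hp1 : p ≤ 1) :
    ∃ k ≤ K, |p - gridPoint δ K k| ≤ 1 / K := by
  have hK' : (0 : ℝ) < K := by exact_mod_cast hK
  -- Treating `p = δ` apart ensures `δ < 1` in the other case, so that division by `1 - δ` is
  -- legitimate.
  rcases hp.eq_or_lt with rfl | hlt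
  · exact ⟨0, by omega, by simp [gridPoint]⟩
  have hd : 0 < 1 - δ := by linarith
  set x : ℝ := (p - δ) / (1 - δ) * K with hx
  have hx0 : 0 ≤ x := by
    have := sub_nonneg.2 hp
    positivity
  have hxK : x ≤ K := by
    have : (p - δ) / (1 - δ) ≤ 1 := by rw [div_le_one hd]; linarith
    nlinarith
  refine ⟨⌊x⌋₊, Nat.floor_le_of_le (by exact_mod_cast hxK), ?_⟩
  have h1 := Nat.floor_le hx0
  have h2 := Nat.lt_floor_add_one x
  have e : p - gridPoint δ K ⌊x⌋₊ = (1 - δ) * ((x - ⌊x⌋₊) / K) := by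
    rw [hx, gridPoint]
    field_simp
    ring
  rw [e, abs_of_nonneg (mul_nonneg hd.le (div_nonneg (by linarith) hK'.le))]
  have h3 : (x - ⌊x⌋₊) / K ≤ 1 / K := by gcongr; linarith
  have h4 : 0 ≤ (x - ⌊x⌋₊) / K := div_nonneg (by linarith) hK'.le
  nlinarith

end Grid

/-! ### Best responses and approximate optimality of their mixture -/

/-- The Bayesian optimal table against the weights `W` on the ratios at the grid points. -/
noncomputable def responseTable (T : ℕ) (B δ : ℝ) (K : ℕ) (W : ℕ → ℝ) : ℕ → ℕ → Bool :=
  bayesTable B (fun k : Fin (K + 1) => gridPoint δ K k)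
    (fun k => W k / (optCost B (gridPoint δ K k) T * gridPoint δ K k)) T

/-- The weights of the grid points after `t` rounds. -/
noncomputable def gridWeight (T : ℕ) (B δ : ℝ) (K : ℕ) (η : ℝ) : ℕ → ℕ → ℝ
  | 0, _ => 1
  | t + 1, k => gridWeight T B δ K η t k *
      (1 + tableRatio B (gridPoint δ K k) T (responseTable T B δ K (gridWeight T B δ K η t)) * η)

/-- The table played in round `t`. -/
noncomputable def roundTable (T : ℕ) (B δ : ℝ) (K : ℕ) (η : ℝ) (t : ℕ) : ℕ → ℕ → Bool :=
  responseTable T B δ K (gridWeight T B δ K η t)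

section Main
variable {T : ℕ} {B δ : ℝ}

theorem ratio_eq (hB : 1 ≤ B) {p : ℝ} (hp : 0 < p) (hp1 : p ≤ 1) (σ : DetAlg T → ℝ) :
    ratio B σ p = ∑ A : DetAlg T, σ A * (expCost B A p / (p * optCost B p T)) := by
  rw [ratio, bayesOpt_eq T (by linarith) hp.le hp1, Finset.sum_div]
  exact Finset.sum_congr rfl fun A _ => by rw [mul_div_assoc]

theorem expCost_le {p : ℝ} (hB : 0 ≤ B) (hp : 0 ≤ p) (hp1 : p ≤ 1) (A : DetAlg T) :
    expCost B A p ≤ T * (B + 1) := by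
  have h : ∀ X, cost B A X ≤ T * (B + 1) := by
    intro X
    refine (Finset.sum_le_card_nsmul _ _ (B + 1) fun i _ => ?_).trans_eq (by simp [mul_add])
    split_ifs <;> linarith
  have h0 : ∀ X : Fin T → Bool, 0 ≤ seqProb p X := fun X => Finset.prod_nonneg fun i _ => by
    split_ifs <;> linarith
  calc expCost B A p ≤ ∑ X : Fin T → Bool, seqProb p X * (T * (B + 1)) :=
        Finset.sum_le_sum fun X _ => mul_le_mul_of_nonneg_left (h X) (h0 X)
    _ = T * (B + 1) := by rw [← Finset.sum_mul, sum_seqProb, one_mul]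

/-- A real supremum over an unbounded set is zero by convention, so some bound is needed before
`worstRatio` dominates the individual ratios. Its dependence on `B` and `δ` is harmless: it enters
no error estimate. -/
theorem bddAbove_ratio (hT : 1 ≤ T) (hB : 1 ≤ B) (hδ : 0 < δ) {σ : DetAlg T → ℝ}
    (hσ : σ ∈ stdSimplex ℝ (DetAlg T)) :
    BddAbove (Set.range fun p : Set.Icc δ (1 : ℝ) => ratio B σ p) := by
  refine ⟨T * (B + 1) / δ, ?_⟩
  rintro _ ⟨⟨p, hp, hp1⟩, rfl⟩
  have hp0 : 0 < p := hδ.trans_le hp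
  have ho := one_le_optCost hB hp0.le hp1 hT
  have h : ∀ A : DetAlg T, expCost B A p / (p * optCost B p T) ≤ T * (B + 1) / δ := fun A =>
    div_le_div₀ (by positivity) (expCost_le (by linarith) hp0.le hp1 A) hδ (by nlinarith)
  calc ratio B σ p ≤ ∑ A : DetAlg T, σ A * (T * (B + 1) / δ) := by
        rw [ratio_eq hB hp0 hp1]
        exact Finset.sum_le_sum fun A _ => mul_le_mul_of_nonneg_left (h A) (hσ.1 A)
    _ = _ := by rw [← Finset.sum_mul, hσ.2, one_mul]

theorem ratio_le_worstRatio (hT : 1 ≤ T) (hB : 1 ≤ B) (hδ : 0 < δ) {σ : DetAlg T → ℝ}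
    (hσ : σ ∈ stdSimplex ℝ (DetAlg T)) {p : ℝ} (hp : δ ≤ p) (hp1 : p ≤ 1) :
    ratio B σ p ≤ worstRatio B δ σ :=
  le_ciSup (bddAbove_ratio hT hB hδ hσ) (⟨p, hp, hp1⟩ : Set.Icc δ (1 : ℝ))

/-- This is weak duality. With prior `W / OPT`, expected cost becomes weighted ratio, so the
response has weighted ratio at most that of every deterministic algorithm, hence of every mixture
`σ`. The ratio of `σ` at each grid point is at most its worst ratio. -/
theorem sum_responseTable_le (hT : 1 ≤ T) (hB : 1 ≤ B) (hδ : 0 < δ) (hδ1 : δ ≤ 1) (K : ℕ)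
    {W : ℕ → ℝ} (hW : ∀ k ≤ K, 0 ≤ W k) {σ : DetAlg T → ℝ} (hσ : σ ∈ stdSimplex ℝ (DetAlg T)) :
    ∑ k : Fin (K + 1), W k * tableRatio B (gridPoint δ K k) T (responseTable T B δ K W) ≤
      worstRatio B δ σ * ∑ k : Fin (K + 1), W k := by
  have hp : ∀ k : Fin (K + 1), 0 < gridPoint δ K k := fun k => gridPoint_pos hδ hδ1 k
  have hp1 : ∀ k : Fin (K + 1), gridPoint δ K k ≤ 1 := fun k =>
    gridPoint_le_one hδ1 (Nat.lt_succ_iff.1 k.isLt)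
  have ho : ∀ k : Fin (K + 1), 1 ≤ optCost B (gridPoint δ K k) T := fun k =>
    one_le_optCost hB (hp k).le (hp1 k) hT
  set v : Fin (K + 1) → ℝ := fun k => W k / (optCost B (gridPoint δ K k) T * gridPoint δ K k)
    with hv
  have hv0 : ∀ k, 0 ≤ v k := fun k => by
    have := hp k
    have := ho k
    exact div_nonneg (hW k (Nat.lt_succ_iff.1 k.isLt)) (by positivity)
  have e1 : ∑ k : Fin (K + 1), W k * tableRatio B (gridPoint δ K k) T (responseTable T B δ K W) =
      bayesValue B (fun k : Fin (K + 1) => gridPoint δ K k) T v := by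
    rw [← sum_tableCost_bayesTable_self]
    refine Finset.sum_congr rfl fun k _ => ?_
    have := (hp k).ne'
    have : optCost B (gridPoint δ K k) T ≠ 0 := by linarith [ho k]
    rw [tableRatio, responseTable, hv]
    field_simp
  have e2 : ∑ k : Fin (K + 1), W k * ratio B σ (gridPoint δ K k) =
      ∑ A : DetAlg T, σ A * ∑ k, v k * expCost B A (gridPoint δ K k) := by
    simp only [ratio_eq hB (hp _) (hp1 _), Finset.mul_sum]
    rw [Finset.sum_comm]
    refine Finset.sum_congr rfl fun A _ => Finset.sum_congr rfl fun k _ => ?_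
    rw [hv, mul_comm (gridPoint δ K k)]
    ring
  calc ∑ k : Fin (K + 1), W k * tableRatio B (gridPoint δ K k) T (responseTable T B δ K W)
      = ∑ A : DetAlg T, σ A * bayesValue B (fun k : Fin (K + 1) => gridPoint δ K k) T v := by
        rw [e1, ← Finset.sum_mul, hσ.2, one_mul]
    _ ≤ ∑ A : DetAlg T, σ A * ∑ k, v k * expCost B A (gridPoint δ K k) :=
        Finset.sum_le_sum fun A _ => mul_le_mul_of_nonneg_left
          (bayesValue_le (by linarith) (fun k => (hp k).le) hp1 A v hv0) (hσ.1 A)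
    _ = ∑ k : Fin (K + 1), W k * ratio B σ (gridPoint δ K k) := e2.symm
    _ ≤ ∑ k : Fin (K + 1), W k * worstRatio B δ σ :=
        Finset.sum_le_sum fun k _ => mul_le_mul_of_nonneg_left
          (ratio_le_worstRatio hT hB hδ hσ (le_gridPoint hδ1 k) (hp1 k))
          (hW k (Nat.lt_succ_iff.1 k.isLt))
    _ = _ := by rw [← Finset.sum_mul, mul_comm]

theorem gridWeight_pos (hB : 1 ≤ B) (hδ : 0 < δ) (hδ1 : δ ≤ 1) {K : ℕ} {η : ℝ}
    (hη : 0 < η) (t : ℕ) {k : ℕ} (hk : k ≤ K) : 0 < gridWeight T B δ K η t k := by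
  induction t with
  | zero => exact one_pos
  | succ t ih =>
    have := tableRatio_nonneg (B := B) (T := T) (by linarith) (gridPoint_pos (K := K) hδ hδ1 k).le
      (gridPoint_le_one hδ1 hk) (responseTable T B δ K (gridWeight T B δ K η t))
    exact mul_pos ih (add_pos_of_pos_of_nonneg one_pos (mul_nonneg this hη.le))

theorem le_of_responseTable (hB : 1 ≤ B) (hT : 1 ≤ T) (hδ : 0 < δ) (hδ1 : δ ≤ 1) {K : ℕ}
    {W : ℕ → ℝ} (hW : ∀ k ≤ K, 0 ≤ W k) {i : ℕ} (hi : i < T) (g : ℕ)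
    (h : responseTable T B δ K W i g = true) : B ≤ T := by
  have hp : ∀ k : Fin (K + 1), 0 < gridPoint δ K k := fun k => gridPoint_pos hδ hδ1 k
  have hp1 : ∀ k : Fin (K + 1), gridPoint δ K k ≤ 1 := fun k =>
    gridPoint_le_one hδ1 (Nat.lt_succ_iff.1 k.isLt)
  refine (lt_of_bayesTable (fun k => (hp k).le) hp1 (fun k => ?_) hi h).le
  have := hp k
  have := one_le_optCost hB (hp k).le (hp1 k) hT
  exact div_nonneg (hW k (Nat.lt_succ_iff.1 k.isLt)) (by positivity)

theorem sum_tableRatio_roundTable_le (hT : 1 ≤ T) (hB : 1 ≤ B) (hδ : 0 < δ) (hδ1 : δ ≤ 1)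
    {K L : ℕ} (hL : K + 1 ≤ 2 ^ L) {η : ℝ} (hη : 0 < η) {σ : DetAlg T → ℝ}
    (hσ : σ ∈ stdSimplex ℝ (DetAlg T)) (N : ℕ) {k : ℕ} (hk : k ≤ K) :
    ∑ t ∈ Finset.range N, tableRatio B (gridPoint δ K k) T (roundTable T B δ K η t) ≤
      N * worstRatio B δ σ + L / η + N * (η * ((T : ℝ) ^ 2) ^ 2) := by
  have hp : ∀ k : Fin (K + 1), 0 < gridPoint δ K k := fun k => gridPoint_pos hδ hδ1 k
  have hp1 : ∀ k : Fin (K + 1), gridPoint δ K k ≤ 1 := fun k =>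
    gridPoint_le_one hδ1 (Nat.lt_succ_iff.1 k.isLt)
  have hW : ∀ t, ∀ k ≤ K, 0 ≤ gridWeight T B δ K η t k := fun t k hk =>
    (gridWeight_pos hB hδ hδ1 hη t hk).le
  exact sum_le_of_multiplicativeWeights (ι := Fin (K + 1))
    (W := fun t k => gridWeight T B δ K η t k)
    (r := fun t k => tableRatio B (gridPoint δ K k) T (roundTable T B δ K η t)) hη
    (fun _ => rfl) (fun _ _ => rfl)
    (fun t k => tableRatio_nonneg (by linarith) (hp k).le (hp1 k) _)
    (fun t k => tableRatio_le hT hB (hp k).le (hp1 k) fun i hi g h =>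
      le_of_responseTable hB hT hδ hδ1 (hW t) hi g h)
    (fun t => sum_responseTable_le hT hB hδ hδ1 K (hW t) hσ) (by simpa using hL) N
    ⟨k, by omega⟩

theorem ratio_uniform_tableAlg (hB : 1 ≤ B) {p : ℝ} (hp : 0 < p) (hp1 : p ≤ 1) (N : ℕ)
    (S : ℕ → ℕ → ℕ → Bool) {σ : DetAlg T → ℝ}
    (hσ : ∀ A, σ A = ∑ n ∈ Finset.range N, if tableAlg T (S n) = A then 1 / (N : ℝ) else 0) :
    ratio B σ p = 1 / (N : ℝ) * ∑ n ∈ Finset.range N, tableRatio B p T (S n) := by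
  rw [ratio_eq hB hp hp1, Finset.mul_sum]
  simp only [hσ, Finset.sum_mul]
  rw [Finset.sum_comm]
  refine Finset.sum_congr rfl fun n _ => ?_
  simp only [ite_mul, zero_mul]
  rw [Finset.sum_ite_eq, if_pos (Finset.mem_univ _), expCost_tableAlg, tableRatio,
    mul_div_mul_left _ _ hp.ne']

theorem uniform_tableAlg_mem_stdSimplex {N : ℕ} (hN : 0 < N)
    (S : ℕ → ℕ → ℕ → Bool) {σ : DetAlg T → ℝ}
    (hσ : ∀ A, σ A = ∑ n ∈ Finset.range N, if tableAlg T (S n) = A then 1 / (N : ℝ) else 0) :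
    σ ∈ stdSimplex ℝ (DetAlg T) := by
  have hN' : (N : ℝ) ≠ 0 := by exact_mod_cast hN.ne'
  constructor
  · intro A
    rw [hσ]
    exact Finset.sum_nonneg fun n _ => by split_ifs <;> positivity
  · simp only [hσ]
    rw [Finset.sum_comm]
    simp [hN']

/-- The uniform mixture of the tables of all rounds is approximately optimal. -/
theorem isApproxOptimal_uniform_roundTable (hT : 1 ≤ T) (hB : 1 ≤ B) (hδ : 0 < δ) (hδ1 : δ ≤ 1)
    {ε : ℝ} {M K L N : ℕ} (hM : 1 ≤ M) (hε : 1 ≤ M * ε) (hK : K = 8 * T ^ 4 * M)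
    (hL : K + 1 ≤ 2 ^ L) (hN : N = 16 * T ^ 4 * M ^ 2 * L) {η : ℝ}
    (hη : η = 1 / (4 * (T : ℝ) ^ 4 * M)) {σ : DetAlg T → ℝ}
    (hσ : ∀ A, σ A = ∑ n ∈ Finset.range N,
      if tableAlg T (roundTable T B δ K η n) = A then 1 / (N : ℝ) else 0) :
    IsApproxOptimal B δ ε σ := by
  have hT' : (0 : ℝ) < T := by exact_mod_cast hT
  have hM' : (0 : ℝ) < M := by exact_mod_cast hM
  have hη0 : 0 < η := by rw [hη]; positivity
  have hKpos : 0 < K := by rw [hK]; positivity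
  have hLpos : 0 < L := by
    rcases Nat.eq_zero_or_pos L with rfl | h
    · simp at hL
      omega
    · exact h
  have hNpos : 0 < N := by rw [hN]; positivity
  have hN' : (0 : ℝ) < N := by exact_mod_cast hNpos
  have hε' : 1 / (M : ℝ) ≤ ε := by rw [div_le_iff₀ hM']; linarith
  have hmem := uniform_tableAlg_mem_stdSimplex hNpos _ hσ
  refine ⟨hmem, ?_⟩
  -- The mixture is compared with an arbitrary rival `σ'` instead of a minimizer, whose existence is
  -- not needed.
  rw [← sub_le_iff_le_add]
  refine le_ciInf fun σ' => ?_
  rw [sub_le_iff_le_add]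
  have : Nonempty (Set.Icc δ (1 : ℝ)) := ⟨⟨1, hδ1, le_rfl⟩⟩
  refine ciSup_le ?_
  rintro ⟨p, hp, hp1⟩
  have hp0 : 0 < p := hδ.trans_le hp
  obtain ⟨k, hk, hpk⟩ := exists_gridPoint_near hKpos hδ hp hp1
  -- Half of the error budget pays for moving from `p` to the grid: slope `4T⁴` times spacing `1 /
  -- (8T⁴M)`.
  have h1 : ∀ t, tableRatio B p T (roundTable T B δ K η t) ≤
      tableRatio B (gridPoint δ K k) T (roundTable T B δ K η t) + 1 / (2 * M) := by
    intro t
    refine (tableRatio_le_add hT hB hp0.le hp1 (gridPoint_pos hδ hδ1 k).le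
      (gridPoint_le_one hδ1 hk) fun i hi g h => le_of_responseTable hB hT hδ hδ1
        (fun k hk => (gridWeight_pos hB hδ hδ1 hη0 t hk).le) hi g h).trans ?_
    have e : 1 / (2 * (M : ℝ)) = 4 * (T : ℝ) ^ 4 * (1 / K) := by
      rw [hK]
      push_cast
      field_simp
      norm_num
    rw [e]
    exact add_le_add le_rfl (by gcongr)
  have h2 := sum_tableRatio_roundTable_le hT hB hδ hδ1 hL hη0 (σ := ⇑σ') σ'.2 N hk
  -- The two regret terms receive a quarter of the budget each. This determines `η` from `η * T ^ 4
  -- = 1 / (4 * M)`, and then `N` from `L / η = N / (4 * M)`.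
  have e1 : (L : ℝ) / η = N * (1 / (4 * M)) := by
    rw [hη, hN]
    push_cast
    field_simp
    norm_num
  have e2 : η * ((T : ℝ) ^ 2) ^ 2 = 1 / (4 * M) := by
    rw [hη]
    field_simp
  rw [e1, e2] at h2
  have h3 := Finset.sum_le_sum fun t (_ : t ∈ Finset.range N) => h1 t
  rw [Finset.sum_add_distrib, Finset.sum_const, Finset.card_range, nsmul_eq_mul] at h3
  have e3 : 1 / (4 * (M : ℝ)) + 1 / (4 * M) + 1 / (2 * M) = 1 / M := by field_simp; norm_num
  change ratio B σ p ≤ _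
  rw [ratio_uniform_tableAlg hB hp0 hp1 N _ hσ, one_div_mul_eq_div, div_le_iff₀ hN']
  calc _ ≤ _ := h3
    _ ≤ N * (worstRatio B δ σ' + 1 / M) := by rw [← e3]; linarith
    _ ≤ _ := by
      rw [mul_comm]
      gcongr

end Main
end SkiRental

/-! ### Write sets and frame conditions for programs -/

namespace RealRAM

namespace Program

/-- The program assigns to natural-number register `u`. -/
def writesNReg : Program → ℕ → Bool
  | .setNReg v _, u => v == u
  | .seq P Q, u => P.writesNReg u || Q.writesNReg u
  | .cond _ P Q, u => P.writesNReg u || Q.writesNReg u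
  | .loop _ P, u => P.writesNReg u
  | _, _ => false

/-- The program assigns to real register `u`. -/
def writesRReg : Program → ℕ → Bool
  | .setRReg v _, u => v == u
  | .seq P Q, u => P.writesRReg u || Q.writesRReg u
  | .cond _ P Q, u => P.writesRReg u || Q.writesRReg u
  | .loop _ P, u => P.writesRReg u
  | _, _ => false

/-- The program assigns to natural-number array `u`. -/
def writesNArr : Program → ℕ → Bool
  | .setNArr v _ _, u => v == u
  | .seq P Q, u => P.writesNArr u || Q.writesNArr u
  | .cond _ P Q, u => P.writesNArr u || Q.writesNArr u
  | .loop _ P, u => P.writesNArr u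
  | _, _ => false

/-- The program assigns to real array `u`. -/
def writesRArr : Program → ℕ → Bool
  | .setRArr v _ _, u => v == u
  | .seq P Q, u => P.writesRArr u || Q.writesRArr u
  | .cond _ P Q, u => P.writesRArr u || Q.writesRArr u
  | .loop _ P, u => P.writesRArr u
  | _, _ => false

end Program

/-- `s` and `s'` agree on everything to which `P` does not assign. -/
structure Frame (P : Program) (s s' : State) : Prop where
  nreg : ∀ v, P.writesNReg v = false → s'.nreg v = s.nreg v
  rreg : ∀ v, P.writesRReg v = false → s'.rreg v = s.rreg v
  narr : ∀ v, P.writesNArr v = false → s'.narr v = s.narr v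
  rarr : ∀ v, P.writesRArr v = false → s'.rarr v = s.rarr v

theorem Frame.rfl {P : Program} {s : State} : Frame P s s :=
  ⟨fun _ _ => Eq.refl _, fun _ _ => Eq.refl _, fun _ _ => Eq.refl _, fun _ _ => Eq.refl _⟩

theorem Frame.trans {P : Program} {s s' s'' : State} (h : Frame P s s') (h' : Frame P s' s'') :
    Frame P s s'' :=
  ⟨fun v hv => (h'.nreg v hv).trans (h.nreg v hv), fun v hv => (h'.rreg v hv).trans (h.rreg v hv),
    fun v hv => (h'.narr v hv).trans (h.narr v hv), fun v hv => (h'.rarr v hv).trans (h.rarr v hv)⟩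

/-- `Q` assigns to everything to which `P` assigns. -/
structure WritesLE (P Q : Program) : Prop where
  nreg : ∀ v, Q.writesNReg v = false → P.writesNReg v = false
  rreg : ∀ v, Q.writesRReg v = false → P.writesRReg v = false
  narr : ∀ v, Q.writesNArr v = false → P.writesNArr v = false
  rarr : ∀ v, Q.writesRArr v = false → P.writesRArr v = false

theorem Frame.mono {P Q : Program} {s s' : State} (h : Frame P s s') (hPQ : WritesLE P Q) :
    Frame Q s s' :=
  ⟨fun v hv => h.nreg v (hPQ.nreg v hv), fun v hv => h.rreg v (hPQ.rreg v hv),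
    fun v hv => h.narr v (hPQ.narr v hv), fun v hv => h.rarr v (hPQ.rarr v hv)⟩

theorem WritesLE.seq_left (P Q : Program) : WritesLE P (.seq P Q) := by
  constructor <;> intro v hv <;>
    simp only [Program.writesNReg, Program.writesRReg, Program.writesNArr, Program.writesRArr,
      Bool.or_eq_false_iff] at hv <;> exact hv.1

theorem WritesLE.seq_right (P Q : Program) : WritesLE Q (.seq P Q) := by
  constructor <;> intro v hv <;>
    simp only [Program.writesNReg, Program.writesRReg, Program.writesNArr, Program.writesRArr,
      Bool.or_eq_false_iff] at hv <;> exact hv.2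

theorem WritesLE.cond_left (b : BExp) (P Q : Program) : WritesLE P (.cond b P Q) := by
  constructor <;> intro v hv <;>
    simp only [Program.writesNReg, Program.writesRReg, Program.writesNArr, Program.writesRArr,
      Bool.or_eq_false_iff] at hv <;> exact hv.1

theorem WritesLE.cond_right (b : BExp) (P Q : Program) : WritesLE Q (.cond b P Q) := by
  constructor <;> intro v hv <;>
    simp only [Program.writesNReg, Program.writesRReg, Program.writesNArr, Program.writesRArr,
      Bool.or_eq_false_iff] at hv <;> exact hv.2

theorem WritesLE.loop (b : BExp) (P : Program) : WritesLE P (.loop b P) :=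
  ⟨fun _ h => h, fun _ h => h, fun _ h => h, fun _ h => h⟩

/-- Assigned locations are found by a Boolean function of the syntax. For a concrete program, the
fact that a register or array is unchanged therefore reduces to a side condition closed by `rfl`. -/
theorem Exec.frame {P : Program} {s s' : State} {t : ℕ} (h : Exec P s t s') : Frame P s s' := by
  have key : ∀ {v u : ℕ}, (v == u) = false → u ≠ v := fun h e => by simp [e] at h
  induction h with
  | skip s => exact .rfl
  | setNReg s v x =>
    exact ⟨fun u hu => Function.update_of_ne (key hu) _ _, fun _ _ => Eq.refl _,
      fun _ _ => Eq.refl _, fun _ _ => Eq.refl _⟩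
  | setRReg s v x =>
    exact ⟨fun _ _ => Eq.refl _, fun u hu => Function.update_of_ne (key hu) _ _,
      fun _ _ => Eq.refl _, fun _ _ => Eq.refl _⟩
  | setNArr s a i x =>
    exact ⟨fun _ _ => Eq.refl _, fun _ _ => Eq.refl _,
      fun u hu => Function.update_of_ne (key hu) _ _, fun _ _ => Eq.refl _⟩
  | setRArr s a i x =>
    exact ⟨fun _ _ => Eq.refl _, fun _ _ => Eq.refl _, fun _ _ => Eq.refl _,
      fun u hu => Function.update_of_ne (key hu) _ _⟩
  | seq _ _ h1 h2 => exact (h1.mono (.seq_left _ _)).trans (h2.mono (.seq_right _ _))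
  | condTrue _ _ h => exact h.mono (.cond_left _ _ _)
  | condFalse _ _ h => exact h.mono (.cond_right _ _ _)
  | loopTrue _ _ _ h1 h2 => exact (h1.mono (.loop _ _)).trans h2
  | loopFalse _ => exact .rfl

/-! ### A Hoare logic with step bounds -/

/-- Started in `s`, the program halts within `n` steps in a memory that satisfies `Q`. -/
def Runs (P : Program) (s : State) (n : ℕ) (Q : State → Prop) : Prop :=
  ∃ t s', Exec P s t s' ∧ t ≤ n ∧ Q s'

theorem Runs.mono {P : Program} {s : State} {m n : ℕ} {Q R : State → Prop} (h : Runs P s m Q)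
    (hmn : m ≤ n) (hQ : ∀ s', Frame P s s' → Q s' → R s') : Runs P s n R := by
  obtain ⟨t, s', he, ht, hq⟩ := h
  exact ⟨t, s', he, ht.trans hmn, hQ s' he.frame hq⟩

theorem Runs.seq {P P' : Program} {s : State} {a b n : ℕ} {Q R : State → Prop} (h : Runs P s a Q)
    (h' : ∀ s', Frame P s s' → Q s' → Runs P' s' b R) (hn : a + b ≤ n := by omega) :
    Runs (.seq P P') s n R := by
  obtain ⟨t, s', he, ht, hq⟩ := h
  obtain ⟨t', s'', he', ht', hr⟩ := h' s' he.frame hq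
  exact ⟨t + t', s'', he.seq he', by omega, hr⟩

theorem Runs.setNReg {v : ℕ} {x : NExp} {s : State} {n : ℕ} {Q : State → Prop}
    (hQ : Q { s with nreg := Function.update s.nreg v (x.eval s) }) (hn : x.time + 1 ≤ n) :
    Runs (.setNReg v x) s n Q :=
  ⟨_, _, .setNReg s v x, hn, hQ⟩

theorem Runs.setRReg {v : ℕ} {x : RExp} {s : State} {n : ℕ} {Q : State → Prop}
    (hQ : Q { s with rreg := Function.update s.rreg v (x.eval s) }) (hn : x.time + 1 ≤ n) :
    Runs (.setRReg v x) s n Q :=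
  ⟨_, _, .setRReg s v x, hn, hQ⟩

theorem Runs.setNArr {a : ℕ} {i x : NExp} {s : State} {n : ℕ} {Q : State → Prop}
    (hQ : Q { s with
      narr := Function.update s.narr a (Function.update (s.narr a) (i.eval s) (x.eval s)) })
    (hn : i.time + x.time + 1 ≤ n) : Runs (.setNArr a i x) s n Q :=
  ⟨_, _, .setNArr s a i x, hn, hQ⟩

theorem Runs.setRArr {a : ℕ} {i : NExp} {x : RExp} {s : State} {n : ℕ} {Q : State → Prop}
    (hQ : Q { s with
      rarr := Function.update s.rarr a (Function.update (s.rarr a) (i.eval s) (x.eval s)) })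
    (hn : i.time + x.time + 1 ≤ n) : Runs (.setRArr a i x) s n Q :=
  ⟨_, _, .setRArr s a i x, hn, hQ⟩

theorem Runs.cond {b : BExp} {P P' : Program} {s : State} {m n : ℕ} {Q : State → Prop}
    (h : b.holds s → Runs P s m Q) (h' : ¬ b.holds s → Runs P' s m Q)
    (hn : b.time + 1 + m ≤ n) : Runs (.cond b P P') s n Q := by
  by_cases hb : b.holds s
  · obtain ⟨t, s', he, ht, hq⟩ := h hb
    exact ⟨_, s', .condTrue hb he, by omega, hq⟩
  · obtain ⟨t, s', he, ht, hq⟩ := h' hb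
    exact ⟨_, s', .condFalse hb he, by omega, hq⟩

/-- The number `m` of iterations is fixed beforehand and the invariant is indexed by the iterations
already made. The guard must hold before each of the `m` iterations and fail afterwards, so one
induction on the remaining iterations yields termination, the step bound and the postcondition. -/
theorem Runs.loop {b : BExp} {P : Program} {s : State} {m c : ℕ} (I : ℕ → State → Prop)
    (h0 : I 0 s)
    (hstep : ∀ j < m, ∀ s', Frame P s s' → I j s' → b.holds s' ∧ Runs P s' c (I (j + 1)))
    (hend : ∀ s', Frame P s s' → I m s' → ¬ b.holds s') :
    Runs (.loop b P) s (m * (c + b.time + 1) + b.time + 1) (I m) := by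
  have key : ∀ d j s', d + j = m → Frame P s s' → I j s' →
      Runs (.loop b P) s' (d * (c + b.time + 1) + b.time + 1) (I m) := by
    intro d
    induction d with
    | zero =>
      intro j s' hj hf hi
      obtain rfl : j = m := by omega
      exact ⟨_, s', .loopFalse (hend s' hf hi), by omega, hi⟩
    | succ d ih =>
      intro j s' hj hf hi
      obtain ⟨hb, t, s'', he, ht, hi'⟩ := hstep j (by omega) s' hf hi
      obtain ⟨t', s''', he', ht', hm⟩ := ih (j + 1) s'' (by omega) (hf.trans he.frame) hi'
      exact ⟨_, s''', .loopTrue hb he he', by rw [Nat.succ_mul]; omega, hm⟩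
  exact key m 0 s rfl .rfl h0

/-- Run `P` with register `v` taking the values `0, 1, …` below `e`. -/
def forLoop (v : ℕ) (e : NExp) (P : Program) : Program :=
  .seq (.setNReg v (.const 0))
    (.loop (.nlt (.reg v) e) (.seq P (.setNReg v (.add (.reg v) (.const 1)))))

/-- The bound `m' ≥ 1` on the number of iterations absorbs the constant overhead, so nested loops
get pure product bounds. The invariant must ignore the counter, which is reset at the start and
incremented after each body. -/
theorem Runs.forLoop {v : ℕ} {e : NExp} {P : Program} {s : State} {m m' c n : ℕ}
    (I : ℕ → State → Prop) (h0 : I 0 s) (hm : m ≤ m') (hm' : 1 ≤ m')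
    (hv : P.writesNReg v = false)
    (he : ∀ s', Frame (forLoop v e P) s s' → e.eval s' = m)
    (hI : ∀ j s' x, I j s' → I j { s' with nreg := Function.update s'.nreg v x })
    (hstep : ∀ j < m, ∀ s', Frame (RealRAM.forLoop v e P) s s' → s'.nreg v = j → I j s' →
      Runs P s' c (I (j + 1)))
    (hn : m' * (c + 2 * e.time + 12) ≤ n) :
    Runs (RealRAM.forLoop v e P) s n (I m) := by
  have lift : ∀ {s₁ s₂}, Frame (.setNReg v (.const 0)) s s₁ →
      Frame (.seq P (.setNReg v (.add (.reg v) (.const 1)))) s₁ s₂ →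
      Frame (RealRAM.forLoop v e P) s s₂ := fun h1 h2 =>
    (h1.mono (.seq_left _ _)).trans ((h2.mono (.loop (.nlt (.reg v) e) _)).mono (.seq_right _ _))
  refine Runs.seq (a := 2) (b := m * (c + 4 + (BExp.nlt (.reg v) e).time + 1) +
      (BExp.nlt (.reg v) e).time + 1)
    (Q := fun s' => I 0 s' ∧ s'.nreg v = 0) (Runs.setNReg ⟨hI 0 s 0 h0, ?_⟩ le_rfl) ?_ ?_
  · exact Function.update_self _ _ _
  · intro s₁ hf₁ h₁
    refine (Runs.loop (fun j s' => I j s' ∧ s'.nreg v = j) h₁ ?_ ?_).mono le_rfl fun _ _ h => h.1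
    · intro j hj s' hf hi
      have hs := lift hf₁ hf
      refine ⟨?_, ?_⟩
      · change s'.nreg v < e.eval s'
        rw [he s' hs, hi.2]
        exact hj
      · refine Runs.seq (a := c) (b := 4) (hstep j hj s' hs hi.2 hi.1) ?_
        intro s'' hf' hi'
        refine Runs.setNReg ⟨hI _ _ _ hi', ?_⟩ le_rfl
        simp only [Function.update_self, NExp.eval]
        rw [hf'.nreg v hv, hi.2]
    · intro s' hf hi
      change ¬ s'.nreg v < e.eval s'
      rw [he s' (lift hf₁ hf), hi.2]
      exact lt_irrefl _
  · refine le_trans ?_ hn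
    have e1 : (BExp.nlt (.reg v) e).time = e.time + 2 := by
      simp only [BExp.time, NExp.time]
      omega
    rw [e1]
    have h1 : m * (c + 4 + (e.time + 2) + 1) ≤ m' * (c + 4 + (e.time + 2) + 1) :=
      Nat.mul_le_mul_right _ hm
    have h2 : m' * (c + 2 * e.time + 12) =
        m' * (c + 4 + (e.time + 2) + 1) + m' * (e.time + 5) := by ring
    have h3 : 1 * (e.time + 5) ≤ m' * (e.time + 5) := Nat.mul_le_mul_right _ hm'
    omega

end RealRAM

namespace SkiRental

open RealRAM

/-! ### Verified computation of the best response -/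

/-- The position of the decision of table `n` on a good day `i` after `g` good days. -/
def tableCell (T n i g : ℕ) : ℕ := ((n * T + i) * T + g) * 2 + 1

theorem mul_add_inj {T a b c d : ℕ} (hb : b < T) (hd : d < T) (h : a * T + b = c * T + d) :
    a = c ∧ b = d := by
  have h1 : b = d := by
    have := congrArg (· % T) h
    simpa [Nat.add_comm, Nat.add_mul_mod_self_right, Nat.mod_eq_of_lt hb, Nat.mod_eq_of_lt hd]
      using this
  subst h1
  exact ⟨Nat.eq_of_mul_eq_mul_right (by omega) (Nat.add_right_cancel h), rfl⟩

/-- The cell is a mixed-radix expansion with digits below `T`. Injectivity ensures that writing one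
decision spoils no other, in particular none of an earlier table. -/
theorem tableCell_inj {T n i g n' i' g' : ℕ} (hi : i < T) (hg : g < T) (hi' : i' < T)
    (hg' : g' < T) (h : tableCell T n i g = tableCell T n' i' g') : n = n' ∧ i = i' ∧ g = g' := by
  have h1 : (n * T + i) * T + g = (n' * T + i') * T + g' := by
    unfold tableCell at h
    omega
  obtain ⟨h2, h3⟩ := mul_add_inj hg hg' h1
  obtain ⟨h4, h5⟩ := mul_add_inj hi hi' h2
  exact ⟨h4, h5, h3⟩

/-- Set entries `0, …, T` of a real array to zero. -/
def zeroProgram (a : ℕ) : Program :=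
  forLoop 10 (.add (.reg 0) (.const 1)) (.setRArr a (.reg 10) (.ofNat (.const 0)))

theorem runs_zeroProgram (a : ℕ) {T : ℕ} {s : State} (hT : 1 ≤ T) (h0 : s.nreg 0 = T) :
    Runs (zeroProgram a) s (44 * T) (fun s' => ∀ g ≤ T, s'.rarr a g = 0) := by
  refine (Runs.forLoop (m := T + 1) (m' := T + 1) (c := 4) (fun j s' => ∀ g < j, s'.rarr a g = 0)
    (by simp) le_rfl (by omega) rfl (fun s' h => ?_) (fun _ _ _ h => h) ?_ le_rfl).mono ?_ ?_
  · rw [NExp.eval, NExp.eval, NExp.eval, h.nreg 0 rfl, h0]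
  · intro j hj s' _ hv hI
    refine Runs.setRArr ?_ (by decide)
    intro g hg
    simp only [Function.update_self, NExp.eval, RExp.eval, hv]
    by_cases h : g = j
    · subst h
      simp
    · rw [Function.update_of_ne h]
      exact hI g (by omega)
  · simp only [NExp.time]
    omega
  · intro s' _ h g hg
    exact h g (by omega)

/-- Multiply `rreg 7` by the probability of a history of `i` days of which `g` are good. -/
def powerProgram : Program :=
  forLoop 11 (.reg 12) (.cond (.nlt (.reg 11) (.reg 10))
    (.setRReg 7 (.mul (.reg 7) (.arr 1 (.reg 7))))
    (.setRReg 7 (.mul (.reg 7) (.sub (.ofNat (.const 1)) (.arr 1 (.reg 7))))))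

theorem runs_powerProgram {T i g k : ℕ} {s : State} (hT : 1 ≤ T) (hi : i ≤ T) (hg : g ≤ i)
    (hsi : s.nreg 12 = i) (hsg : s.nreg 10 = g) (hsk : s.nreg 7 = k) :
    Runs powerProgram s (26 * T) (fun s' => s'.rreg 7 =
      s.rreg 7 * s.rarr 1 k ^ g * (1 - s.rarr 1 k) ^ (i - g)) := by
  -- The first `g` passes multiply by `p` and the others by `1 - p`; `min j g` and the truncated `j
  -- - g` cover both phases with one invariant.
  refine (Runs.forLoop (m := i) (m' := T) (c := 12) (fun j s' => s'.rreg 7 =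
      s.rreg 7 * s.rarr 1 k ^ (min j g) * (1 - s.rarr 1 k) ^ (j - g))
    (by simp) hi hT rfl (fun s' h => ?_) (fun _ _ _ h => h) ?_ le_rfl).mono ?_ ?_
  · rw [NExp.eval, h.nreg 12 rfl, hsi]
  · intro j hj s' hf hv hI
    have e1 : s'.rarr 1 = s.rarr 1 := hf.rarr 1 rfl
    have e2 : s'.nreg 7 = k := (hf.nreg 7 rfl).trans hsk
    have e3 : s'.nreg 10 = g := (hf.nreg 10 rfl).trans hsg
    refine Runs.cond (m := 8) (fun hb => ?_) (fun hb => ?_) (by decide)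
    · refine Runs.setRReg ?_ (by decide)
      simp only [BExp.holds, NExp.eval, hv, e3] at hb
      simp only [Function.update_self, RExp.eval, NExp.eval, e1, e2, hI]
      rw [min_eq_left hb.le, min_eq_left hb, Nat.sub_eq_zero_of_le hb.le, Nat.sub_eq_zero_of_le hb]
      ring
    · refine Runs.setRReg ?_ (by decide)
      simp only [BExp.holds, NExp.eval, hv, e3, not_lt] at hb
      simp only [Function.update_self, RExp.eval, NExp.eval, e1, e2, hI]
      rw [min_eq_right hb, min_eq_right (by omega), Nat.sub_add_comm hb]
      push_cast
      ring
  · simp only [NExp.time]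
    omega
  · intro s' _ h
    rw [h, min_eq_right hg]

/-- Compute in `rreg 6` the weight of the histories of `i` days of which `g` are good. -/
def massProgram : Program :=
  .seq (.setRReg 6 (.ofNat (.const 0)))
    (forLoop 7 (.add (.reg 1) (.const 1))
      (.seq (.setRReg 7 (.div (.arr 3 (.reg 7)) (.arr 2 (.reg 7))))
        (.seq powerProgram (.setRReg 6 (.add (.reg 6) (.reg 7))))))

theorem runs_massProgram {T K i g : ℕ} {s : State} (hT : 1 ≤ T) (hi : i ≤ T) (hg : g ≤ i)
    (hsK : s.nreg 1 = K) (hsi : s.nreg 12 = i) (hsg : s.nreg 10 = g) :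
    Runs massProgram s (57 * ((K + 1) * T)) (fun s' => s'.rreg 6 =
      ∑ k ∈ Finset.range (K + 1),
        s.rarr 3 k / s.rarr 2 k * s.rarr 1 k ^ g * (1 - s.rarr 1 k) ^ (i - g)) := by
  refine Runs.seq (a := 3) (b := (K + 1) * (26 * T + 28)) (Q := fun s' => s'.rreg 6 = 0)
    (Runs.setRReg (by simp [RExp.eval, NExp.eval]) (by decide)) ?_ (by nlinarith)
  intro s₁ hf₁ h₁
  refine Runs.forLoop (m := K + 1) (m' := K + 1) (c := 26 * T + 10) (fun j s' => s'.rreg 6 =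
      ∑ k ∈ Finset.range j,
        s.rarr 3 k / s.rarr 2 k * s.rarr 1 k ^ g * (1 - s.rarr 1 k) ^ (i - g))
    (by simpa using h₁) le_rfl (by omega) rfl (fun s' h => ?_) (fun _ _ _ h => h) ?_ ?_
  · rw [NExp.eval, NExp.eval, NExp.eval, h.nreg 1 rfl, hf₁.nreg 1 rfl, hsK]
  · intro j hj s' hf hv hI
    have ea : ∀ a, s'.rarr a = s.rarr a := fun a => (hf.rarr a rfl).trans (hf₁.rarr a rfl)
    have ei : s'.nreg 12 = i := ((hf.nreg 12 rfl).trans (hf₁.nreg 12 rfl)).trans hsi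
    have eg : s'.nreg 10 = g := ((hf.nreg 10 rfl).trans (hf₁.nreg 10 rfl)).trans hsg
    refine Runs.seq (a := 6) (b := 26 * T + 4) (Q := fun s'' => s''.rreg 7 =
      s.rarr 3 j / s.rarr 2 j) (Runs.setRReg ?_ (by decide)) ?_
    · simp [RExp.eval, NExp.eval, ea, hv]
    intro s₂ hf₂ h₂
    refine Runs.seq (a := 26 * T) (b := 4) (runs_powerProgram hT hi hg
      ((hf₂.nreg 12 rfl).trans ei) ((hf₂.nreg 10 rfl).trans eg) ((hf₂.nreg 7 rfl).trans hv)) ?_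
    intro s₃ hf₃ h₃
    refine Runs.setRReg ?_ (by decide)
    simp only [Function.update_self, RExp.eval]
    rw [h₃, hf₃.rreg 6 rfl, hf₂.rreg 6 rfl, hI, Finset.sum_range_succ, h₂, hf₂.rarr 1 rfl, ea 1]
  · simp only [NExp.time]
    exact Nat.mul_le_mul_left _ (by omega)

/-- The position of the current table cell. -/
def cellExp : NExp :=
  .add (.mul (.add (.mul (.add (.mul (.reg 8) (.reg 0)) (.reg 12)) (.reg 0)) (.reg 10)) (.const 2))
    (.const 1)

theorem cellExp_eval (s : State) :
    cellExp.eval s = tableCell (s.nreg 0) (s.nreg 8) (s.nreg 12) (s.nreg 10) := rfl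

/-- One cell of the backward induction. -/
def responseCellProgram : Program :=
  .seq massProgram
    (.cond (.rlt (.mul (.reg 0) (.reg 6)) (.add (.reg 6) (.arr 4 (.add (.reg 10) (.const 1)))))
      (.seq (.setRArr 4 (.reg 10) (.add (.mul (.reg 0) (.reg 6)) (.arr 4 (.reg 10))))
        (.setNArr 0 cellExp (.const 1)))
      (.seq (.setRArr 4 (.reg 10) (.add (.add (.reg 6) (.arr 4 (.add (.reg 10) (.const 1))))
          (.arr 4 (.reg 10))))
        (.setNArr 0 cellExp (.const 0))))

/-- One row of the backward induction. -/
def responseRowProgram : Program :=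
  forLoop 10 (.add (.reg 12) (.const 1)) responseCellProgram

/-- The backward induction that computes table `nreg 8`. -/
def responseProgram : Program :=
  .seq (zeroProgram 4)
    (forLoop 9 (.reg 0)
      (.seq (.setNReg 12 (.sub (.reg 0) (.add (.reg 9) (.const 1)))) responseRowProgram))

section Response
variable {T K t : ℕ} {B : ℝ} {s : State} {mass V : ℕ → ℕ → ℝ} {S : ℕ → ℕ → Bool}

theorem runs_responseCellProgram {i g : ℕ} (hi : i < T) (hg : g ≤ i)
    (h0 : s.nreg 0 = T) (hsK : s.nreg 1 = K) (hst : s.nreg 8 = t) (hsi : s.nreg 12 = i)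
    (hsg : s.nreg 10 = g) (hB : s.rreg 0 = B)
    (hmass : mass i g = ∑ k ∈ Finset.range (K + 1),
      s.rarr 3 k / s.rarr 2 k * s.rarr 1 k ^ g * (1 - s.rarr 1 k) ^ (i - g))
    (hS : S i g = decide (B * mass i g < mass i g + V (i + 1) (g + 1)))
    (hV : V i g = (if S i g = true then B * mass i g else mass i g + V (i + 1) (g + 1)) +
      V (i + 1) g)
    (h1 : s.rarr 4 (g + 1) = V (i + 1) (g + 1)) (h2 : s.rarr 4 g = V (i + 1) g) :
    Runs responseCellProgram s (94 * ((K + 1) * T)) (fun s' =>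
      s'.rarr 4 = Function.update (s.rarr 4) g (V i g) ∧
      s'.narr 0 = Function.update (s.narr 0) (tableCell T t i g) (S i g).toNat) := by
  have hT : 1 ≤ T := by omega
  have hKT : 1 ≤ (K + 1) * T := Nat.mul_pos (by omega) hT
  refine Runs.seq (a := 57 * ((K + 1) * T)) (b := 37)
    (runs_massProgram hT hi.le hg hsK hsi hsg) ?_ (by omega)
  intro s₁ hf₁ h₁
  rw [← hmass] at h₁
  have e4 : s₁.rarr 4 = s.rarr 4 := hf₁.rarr 4 rfl
  have en : s₁.narr 0 = s.narr 0 := hf₁.narr 0 rfl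
  have eg : s₁.nreg 10 = g := (hf₁.nreg 10 rfl).trans hsg
  have ec : cellExp.eval s₁ = tableCell T t i g := by
    rw [cellExp_eval, eg, hf₁.nreg 0 rfl, hf₁.nreg 8 rfl, hf₁.nreg 12 rfl, h0, hst, hsi]
  have eB : s₁.rreg 0 = B := (hf₁.rreg 0 rfl).trans hB
  refine Runs.cond (m := 26) (fun hb => ?_) (fun hb => ?_) (by decide)
  · simp only [BExp.holds, RExp.eval, NExp.eval, eB, h₁, e4, eg, h1] at hb
    have hS' : S i g = true := by rw [hS]; exact decide_eq_true hb
    refine Runs.seq (a := 8) (b := 15) (Q := fun s' =>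
      s'.rarr 4 = Function.update (s.rarr 4) g (V i g)) (Runs.setRArr ?_ (by decide)) ?_
    · simp only [Function.update_self, RExp.eval, NExp.eval, eB, h₁, e4, eg, h2, hV, hS', if_true]
    · intro s₂ hf₂ h₂
      refine Runs.setNArr ⟨h₂, ?_⟩ (by decide)
      have ec' : cellExp.eval s₂ = tableCell T t i g := by
        rw [← ec, cellExp_eval, cellExp_eval, hf₂.nreg 0 rfl, hf₂.nreg 8 rfl, hf₂.nreg 12 rfl,
          hf₂.nreg 10 rfl]
      simp only [Function.update_self, ec', hf₂.narr 0 rfl, en, hS']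
      rfl
  · simp only [BExp.holds, RExp.eval, NExp.eval, eB, h₁, e4, eg, h1] at hb
    have hS' : S i g = false := by rw [hS]; exact decide_eq_false hb
    refine Runs.seq (a := 11) (b := 15) (Q := fun s' =>
      s'.rarr 4 = Function.update (s.rarr 4) g (V i g)) (Runs.setRArr ?_ (by decide)) ?_
    · simp only [Function.update_self, RExp.eval, NExp.eval, h₁, e4, eg, h1, h2, hV, hS',
        Bool.false_eq_true, if_false]
    · intro s₂ hf₂ h₂
      refine Runs.setNArr ⟨h₂, ?_⟩ (by decide)
      have ec' : cellExp.eval s₂ = tableCell T t i g := by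
        rw [← ec, cellExp_eval, cellExp_eval, hf₂.nreg 0 rfl, hf₂.nreg 8 rfl, hf₂.nreg 12 rfl,
          hf₂.nreg 10 rfl]
      simp only [Function.update_self, ec', hf₂.narr 0 rfl, en, hS']
      rfl

/-- One array serves two consecutive rows. Cell `g` reads entries `g` and `g + 1` of row `i + 1` and
overwrites only entry `g`, which no later cell reads, because `g` increases. -/
theorem runs_responseRowProgram {i : ℕ} (hi : i < T)
    (h0 : s.nreg 0 = T) (hsK : s.nreg 1 = K) (hst : s.nreg 8 = t) (hsi : s.nreg 12 = i)
    (hB : s.rreg 0 = B)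
    (hmass : ∀ g ≤ i, mass i g = ∑ k ∈ Finset.range (K + 1),
      s.rarr 3 k / s.rarr 2 k * s.rarr 1 k ^ g * (1 - s.rarr 1 k) ^ (i - g))
    (hS : ∀ g ≤ i, S i g = decide (B * mass i g < mass i g + V (i + 1) (g + 1)))
    (hV : ∀ g ≤ i, V i g = (if S i g = true then B * mass i g else mass i g + V (i + 1) (g + 1)) +
      V (i + 1) g)
    (h1 : ∀ g ≤ i + 1, s.rarr 4 g = V (i + 1) g) :
    Runs responseRowProgram s (112 * ((K + 1) * T * T)) (fun s' =>
      (∀ g ≤ i, s'.rarr 4 g = V i g) ∧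
      (∀ g ≤ i, s'.narr 0 (tableCell T t i g) = (S i g).toNat) ∧
      ∀ q, (∀ g ≤ i, q ≠ tableCell T t i g) → s'.narr 0 q = s.narr 0 q) := by
  have hT : 1 ≤ T := by omega
  have hKT : 1 ≤ (K + 1) * T := Nat.mul_pos (by omega) hT
  refine (Runs.forLoop (m := i + 1) (m' := T) (c := 94 * ((K + 1) * T)) (fun j s' =>
      (∀ g < j, s'.rarr 4 g = V i g) ∧ (∀ g, j ≤ g → s'.rarr 4 g = s.rarr 4 g) ∧
      (∀ g < j, s'.narr 0 (tableCell T t i g) = (S i g).toNat) ∧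
      ∀ q, (∀ g ≤ i, q ≠ tableCell T t i g) → s'.narr 0 q = s.narr 0 q)
    (by simp) hi hT rfl (fun s' h => ?_) (fun _ _ _ h => h) ?_ le_rfl).mono ?_ ?_
  · rw [NExp.eval, NExp.eval, NExp.eval, h.nreg 12 rfl, hsi]
  · intro j hj s' hf hv hI
    obtain ⟨i1, i2, i3, i4⟩ := hI
    refine (runs_responseCellProgram (mass := mass) (V := V) (S := S) hi (by omega : j ≤ i)
      ((hf.nreg 0 rfl).trans h0) ((hf.nreg 1 rfl).trans hsK) ((hf.nreg 8 rfl).trans hst)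
      ((hf.nreg 12 rfl).trans hsi) hv ((hf.rreg 0 rfl).trans hB) ?_ (hS j (by omega))
      (hV j (by omega)) ?_ ?_).mono le_rfl ?_
    · rw [hmass j (by omega), hf.rarr 1 rfl, hf.rarr 2 rfl, hf.rarr 3 rfl]
    · rw [i2 _ (by omega), h1 _ (by omega)]
    · rw [i2 _ le_rfl, h1 _ (by omega)]
    · rintro s'' - ⟨u1, u2⟩
      refine ⟨fun g hg => ?_, fun g hg => ?_, fun g hg => ?_, fun q hq => ?_⟩
      · rw [u1]
        by_cases h : g = j
        · rw [h, Function.update_self]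
        · rw [Function.update_of_ne h, i1 g (by omega)]
      · rw [u1, Function.update_of_ne (by omega), i2 g (by omega)]
      · rw [u2]
        by_cases h : g = j
        · rw [h, Function.update_self]
        · rw [Function.update_of_ne, i3 g (by omega)]
          exact fun e => h (tableCell_inj hi (by omega) hi (by omega) e).2.2
      · rw [u2, Function.update_of_ne (hq j (by omega)), i4 q hq]
  · simp only [NExp.time]
    nlinarith
  · rintro s' - ⟨i1, -, i3, i4⟩
    exact ⟨fun g hg => i1 g (by omega), fun g hg => i3 g (by omega), i4⟩

theorem runs_responseProgram (hT : 1 ≤ T)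
    (h0 : s.nreg 0 = T) (hsK : s.nreg 1 = K) (hst : s.nreg 8 = t) (hB : s.rreg 0 = B)
    (hmass : ∀ i < T, ∀ g ≤ i, mass i g = ∑ k ∈ Finset.range (K + 1),
      s.rarr 3 k / s.rarr 2 k * s.rarr 1 k ^ g * (1 - s.rarr 1 k) ^ (i - g))
    (hS : ∀ i < T, ∀ g ≤ i, S i g = decide (B * mass i g < mass i g + V (i + 1) (g + 1)))
    (hV : ∀ i < T, ∀ g ≤ i, V i g =
      (if S i g = true then B * mass i g else mass i g + V (i + 1) (g + 1)) + V (i + 1) g)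
    (hVT : ∀ g, V T g = 0) :
    Runs responseProgram s (176 * ((K + 1) * T * T * T)) (fun s' =>
      (∀ i < T, ∀ g ≤ i, s'.narr 0 (tableCell T t i g) = (S i g).toNat) ∧
      ∀ q, (∀ i < T, ∀ g ≤ i, q ≠ tableCell T t i g) → s'.narr 0 q = s.narr 0 q) := by
  have hKT : 1 ≤ (K + 1) * T * T :=
    Nat.mul_pos (Nat.mul_pos (by omega) hT) hT
  refine Runs.seq (a := 44 * T) (b := T * (112 * ((K + 1) * T * T) + 20))
    (runs_zeroProgram 4 hT h0) ?_ (by nlinarith)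
  intro s₁ hf₁ h₁
  -- The loop runs upwards while days run backwards: after `j` passes the array holds row `T - j`,
  -- starting from the zero row at the horizon.
  refine (Runs.forLoop (m := T) (m' := T) (c := 112 * ((K + 1) * T * T) + 6) (fun j s' =>
      (∀ g ≤ T - j, s'.rarr 4 g = V (T - j) g) ∧
      (∀ i < T, T - j ≤ i → ∀ g ≤ i, s'.narr 0 (tableCell T t i g) = (S i g).toNat) ∧
      ∀ q, (∀ i < T, ∀ g ≤ i, q ≠ tableCell T t i g) → s'.narr 0 q = s.narr 0 q)
    ⟨fun g hg => ?_, fun i hi hi' => by omega, fun q _ => by rw [hf₁.narr 0 rfl]⟩ le_rfl hT rfl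
    (fun s' h => ?_) (fun _ _ _ h => h) ?_ le_rfl).mono ?_ ?_
  · rw [h₁ g (by omega), Nat.sub_zero, hVT]
  · rw [NExp.eval, h.nreg 0 rfl, hf₁.nreg 0 rfl, h0]
  · intro j hj s' hf hv hI
    obtain ⟨i1, i2, i3⟩ := hI
    have e0 : s'.nreg 0 = T := ((hf.nreg 0 rfl).trans (hf₁.nreg 0 rfl)).trans h0
    have hi : T - (j + 1) < T := by omega
    have hi1 : T - (j + 1) + 1 = T - j := by omega
    refine Runs.seq (a := 6) (b := 112 * ((K + 1) * T * T))
      (Q := fun s'' => s''.nreg 12 = T - (j + 1)) (Runs.setNReg ?_ (by decide)) ?_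
    · simp only [Function.update_self, NExp.eval, e0, hv]
    intro s₂ hf₂ h₂
    refine (runs_responseRowProgram (mass := mass) (V := V) (S := S) hi
      ((hf₂.nreg 0 rfl).trans e0)
      ((hf₂.nreg 1 rfl).trans (((hf.nreg 1 rfl).trans (hf₁.nreg 1 rfl)).trans hsK))
      ((hf₂.nreg 8 rfl).trans (((hf.nreg 8 rfl).trans (hf₁.nreg 8 rfl)).trans hst)) h₂
      ((hf₂.rreg 0 rfl).trans (((hf.rreg 0 rfl).trans (hf₁.rreg 0 rfl)).trans hB)) ?_
      (hS _ hi) (hV _ hi) ?_).mono le_rfl ?_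
    · intro g hg
      rw [hmass _ hi g hg, hf₂.rarr 1 rfl, hf₂.rarr 2 rfl, hf₂.rarr 3 rfl, hf.rarr 1 rfl,
        hf.rarr 2 rfl, hf.rarr 3 rfl, hf₁.rarr 1 rfl, hf₁.rarr 2 rfl, hf₁.rarr 3 rfl]
    · intro g hg
      rw [hf₂.rarr 4 rfl, hi1, i1 g (by omega)]
    · rintro s'' - ⟨u1, u2, u3⟩
      refine ⟨u1, fun i hi2 hi3 g hg => ?_, fun q hq => ?_⟩
      · by_cases h : i = T - (j + 1)
        · subst h
          exact u2 g hg
        · rw [u3, hf₂.narr 0 rfl, i2 i hi2 (by omega) g hg]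
          intro g' hg' e
          exact h (tableCell_inj hi2 (by omega) hi (by omega) e).2.1
      · rw [u3 q (hq _ hi), hf₂.narr 0 rfl, i3 q hq]
  · simp only [NExp.time]
    exact Nat.mul_le_mul_left _ (by omega)
  · rintro s' - ⟨-, i2, i3⟩
    exact ⟨fun i hi g hg => i2 i hi (by omega) g hg, i3⟩

end Response


/-! ### Verified evaluation of a table at a grid point -/

/-- The contribution of a bad day to the evaluation of a table. -/
def badDayExp : RExp := .mul (.sub (.ofNat (.const 1)) (.arr 1 (.reg 7))) (.arr 5 (.reg 10))

/-- One cell of the evaluation of a table. -/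
def evaluationCellProgram : Program :=
  .cond (.nlt (.const 0) (.arr 0 cellExp))
    (.setRArr 5 (.reg 10) (.add (.reg 0) badDayExp))
    (.setRArr 5 (.reg 10) (.add (.add (.ofNat (.const 1))
      (.mul (.arr 1 (.reg 7)) (.arr 5 (.add (.reg 10) (.const 1))))) badDayExp))

/-- The evaluation of a table at a grid point and the update of the weight of the point. -/
def evaluationProgram : Program :=
  .seq (zeroProgram 5)
    (.seq
      (forLoop 9 (.reg 0)
        (.seq (.setNReg 12 (.sub (.reg 0) (.add (.reg 9) (.const 1))))
          (forLoop 10 (.add (.reg 12) (.const 1)) evaluationCellProgram)))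
      (.setRArr 3 (.reg 7) (.mul (.arr 3 (.reg 7)) (.add (.ofNat (.const 1))
        (.mul (.div (.arr 5 (.const 0)) (.arr 2 (.reg 7))) (.reg 3))))))

section Evaluation
variable {T t k : ℕ} {B p : ℝ} {s : State} {S : ℕ → ℕ → Bool}

theorem runs_evaluationCellProgram {n i g : ℕ} (h0 : s.nreg 0 = T) (hst : s.nreg 8 = t)
    (hsi : s.nreg 12 = i) (hsg : s.nreg 10 = g) (hsk : s.nreg 7 = k) (hB : s.rreg 0 = B)
    (hp : s.rarr 1 k = p) (hS : s.narr 0 (tableCell T t i g) = (S i g).toNat)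
    (h1 : s.rarr 5 (g + 1) = tableCost B p n (dropTable S (i + 1) (g + 1)))
    (h2 : s.rarr 5 g = tableCost B p n (dropTable S (i + 1) g)) :
    Runs evaluationCellProgram s 38 (fun s' => s'.rarr 5 =
      Function.update (s.rarr 5) g (tableCost B p (n + 1) (dropTable S i g))) := by
  have ec : cellExp.eval s = tableCell T t i g := by rw [cellExp_eval, h0, hst, hsi, hsg]
  refine Runs.cond (m := 21) (fun hb => ?_) (fun hb => ?_) (by decide)
  · have hS' : S i g = true := by
      simp only [BExp.holds, NExp.eval, ec, hS] at hb
      revert hb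
      cases S i g <;> simp
    refine Runs.setRArr ?_ (by decide)
    simp only [Function.update_self, RExp.eval, NExp.eval, badDayExp, hsg, hsk, hp, hB, h2,
      tableCost_dropTable_succ, hS', if_true, Nat.cast_one]
  · have hS' : S i g = false := by
      simp only [BExp.holds, NExp.eval, ec, hS] at hb
      revert hb
      cases S i g <;> simp
    refine Runs.setRArr ?_ (by decide)
    simp only [Function.update_self, RExp.eval, NExp.eval, badDayExp, hsg, hsk, hp, h1, h2,
      tableCost_dropTable_succ, hS', Bool.false_eq_true, if_false, Nat.cast_one]

theorem runs_evaluationRow {n i : ℕ} (hi : i < T) (h0 : s.nreg 0 = T) (hst : s.nreg 8 = t)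
    (hsi : s.nreg 12 = i) (hsk : s.nreg 7 = k) (hB : s.rreg 0 = B)
    (hp : s.rarr 1 k = p) (hS : ∀ g ≤ i, s.narr 0 (tableCell T t i g) = (S i g).toNat)
    (h1 : ∀ g ≤ i + 1, s.rarr 5 g = tableCost B p n (dropTable S (i + 1) g)) :
    Runs (forLoop 10 (.add (.reg 12) (.const 1)) evaluationCellProgram) s (56 * T)
      (fun s' => ∀ g ≤ i, s'.rarr 5 g = tableCost B p (n + 1) (dropTable S i g)) := by
  refine (Runs.forLoop (m := i + 1) (m' := T) (c := 38) (fun j s' =>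
      (∀ g < j, s'.rarr 5 g = tableCost B p (n + 1) (dropTable S i g)) ∧
      (∀ g, j ≤ g → s'.rarr 5 g = s.rarr 5 g))
    (by simp) hi (by omega) rfl (fun s' h => ?_) (fun _ _ _ h => h) ?_ le_rfl).mono ?_ ?_
  · rw [NExp.eval, NExp.eval, NExp.eval, h.nreg 12 rfl, hsi]
  · intro j hj s' hf hv hI
    obtain ⟨i1, i2⟩ := hI
    refine (runs_evaluationCellProgram (T := T) (t := t) (k := k) (B := B) (p := p) (S := S)
      (n := n) (i := i) (g := j)
      ((hf.nreg 0 rfl).trans h0) ((hf.nreg 8 rfl).trans hst)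
      ((hf.nreg 12 rfl).trans hsi) hv ((hf.nreg 7 rfl).trans hsk) ((hf.rreg 0 rfl).trans hB)
      (by rw [hf.rarr 1 rfl, hp]) (by rw [hf.narr 0 rfl, hS j (by omega)]) ?_ ?_).mono le_rfl ?_
    · rw [i2 _ (by omega), h1 _ (by omega)]
    · rw [i2 _ le_rfl, h1 _ (by omega)]
    · intro s'' _ u1
      refine ⟨fun g hg => ?_, fun g hg => ?_⟩
      · rw [u1]
        by_cases h : g = j
        · rw [h, Function.update_self]
        · rw [Function.update_of_ne h, i1 g (by omega)]
      · rw [u1, Function.update_of_ne (by omega), i2 g (by omega)]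
  · simp only [NExp.time]
    omega
  · rintro s' - ⟨i1, -⟩ g hg
    exact i1 g (by omega)

/-- For a fixed `p` the same in-place backward induction applies with the decisions read from
memory, so a grid point costs only `O(T²)` steps. The final assignment is the multiplicative update
with learning rate `rreg 3`. -/
theorem runs_evaluationProgram (hT : 1 ≤ T) (h0 : s.nreg 0 = T) (hst : s.nreg 8 = t)
    (hsk : s.nreg 7 = k) (hB : s.rreg 0 = B) (hp : s.rarr 1 k = p)
    (hS : ∀ i < T, ∀ g ≤ i, s.narr 0 (tableCell T t i g) = (S i g).toNat) :
    Runs evaluationProgram s (135 * (T * T)) (fun s' => s'.rarr 3 = Function.update (s.rarr 3) k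
      (s.rarr 3 k * (1 + tableCost B p T S / s.rarr 2 k * s.rreg 3))) := by
  refine Runs.seq (a := 44 * T) (b := 76 * (T * T) + 15) (runs_zeroProgram 5 hT h0) ?_
    (by nlinarith)
  intro s₁ hf₁ h₁
  refine Runs.seq (a := 76 * (T * T)) (b := 15)
    ((Runs.forLoop (m := T) (m' := T) (c := 56 * T + 6) (fun j s' =>
      ∀ g ≤ T - j, s'.rarr 5 g = tableCost B p j (dropTable S (T - j) g))
    (fun g hg => ?_) le_rfl hT rfl
    (fun s' h => ?_) (fun _ _ _ h => h) ?_ le_rfl).mono ?_ fun _ _ h => h) ?_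
  · rw [h₁ g (by omega), tableCost]
  · rw [NExp.eval, h.nreg 0 rfl, hf₁.nreg 0 rfl, h0]
  · intro j hj s' hf hv hI
    have e0 : s'.nreg 0 = T := ((hf.nreg 0 rfl).trans (hf₁.nreg 0 rfl)).trans h0
    have hi : T - (j + 1) < T := by omega
    have hi1 : T - (j + 1) + 1 = T - j := by omega
    refine Runs.seq (a := 6) (b := 56 * T)
      (Q := fun s'' => s''.nreg 12 = T - (j + 1)) (Runs.setNReg ?_ (by decide)) ?_
    · simp only [Function.update_self, NExp.eval, e0, hv]
    intro s₂ hf₂ h₂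
    refine runs_evaluationRow (T := T) (t := t) (k := k) hi
      ((hf₂.nreg 0 rfl).trans e0)
      ((hf₂.nreg 8 rfl).trans (((hf.nreg 8 rfl).trans (hf₁.nreg 8 rfl)).trans hst)) h₂
      ((hf₂.nreg 7 rfl).trans (((hf.nreg 7 rfl).trans (hf₁.nreg 7 rfl)).trans hsk))
      ((hf₂.rreg 0 rfl).trans (((hf.rreg 0 rfl).trans (hf₁.rreg 0 rfl)).trans hB)) ?_ ?_ ?_
    · rw [hf₂.rarr 1 rfl, hf.rarr 1 rfl, hf₁.rarr 1 rfl, hp]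
    · intro g hg
      rw [hf₂.narr 0 rfl, hf.narr 0 rfl, hf₁.narr 0 rfl, hS _ hi g hg]
    · intro g hg
      rw [hf₂.rarr 5 rfl, hi1, hI g (by omega)]
  · simp only [NExp.time]
    nlinarith
  · intro s₂ hf₂ h₂
    have h3 := h₂ 0 (by omega)
    have e : dropTable S (T - T) 0 = S := by
      funext i g
      simp [dropTable]
    rw [e] at h3
    have ek : s₂.nreg 7 = k := ((hf₂.nreg 7 rfl).trans (hf₁.nreg 7 rfl)).trans hsk
    refine Runs.setRArr ?_ (by decide)
    simp only [Function.update_self, RExp.eval, NExp.eval, ek, h3, hf₂.rarr 3 rfl, hf₂.rarr 2 rfl,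
      hf₁.rarr 3 rfl, hf₁.rarr 2 rfl, hf₂.rreg 3 rfl, hf₁.rreg 3 rfl, Nat.cast_one]

end Evaluation

/-! ### Grid, parameters, rounds and the whole program -/

/-- One round of the multiplicative weights method. -/
def roundProgram : Program :=
  .seq (.setRArr 0 (.reg 8) (.div (.ofNat (.const 1)) (.ofNat (.reg 6))))
    (.seq responseProgram (forLoop 7 (.add (.reg 1) (.const 1)) evaluationProgram))

/-- The grid points, the optimal costs there, and the initial weights. -/
def gridProgram : Program :=
  forLoop 7 (.add (.reg 1) (.const 1))
    (.seq
      (.setRArr 1 (.reg 7) (.add (.reg 1) (.mul (.sub (.ofNat (.const 1)) (.reg 1))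
        (.div (.ofNat (.reg 7)) (.ofNat (.reg 1))))))
      (.seq (.setRReg 5 (.ofNat (.const 0)))
        (.seq
          (forLoop 9 (.reg 0)
            (.cond (.rlt (.reg 0) (.add (.ofNat (.const 1)) (.mul (.arr 1 (.reg 7)) (.reg 5))))
              (.setRReg 5 (.add (.reg 0)
                (.mul (.sub (.ofNat (.const 1)) (.arr 1 (.reg 7))) (.reg 5))))
              (.setRReg 5 (.add (.add (.ofNat (.const 1)) (.mul (.arr 1 (.reg 7)) (.reg 5)))
                (.mul (.sub (.ofNat (.const 1)) (.arr 1 (.reg 7))) (.reg 5))))))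
          (.seq (.setRArr 2 (.reg 7) (.reg 5)) (.setRArr 3 (.reg 7) (.ofNat (.const 1)))))))

theorem runs_gridProgram {T K : ℕ} {B δ : ℝ} {s : State} (hT : 1 ≤ T) (h0 : s.nreg 0 = T)
    (hK : s.nreg 1 = K) (hB : s.rreg 0 = B) (hδ : s.rreg 1 = δ) :
    Runs gridProgram s (82 * ((K + 1) * T)) (fun s' => ∀ k ≤ K,
      s'.rarr 1 k = gridPoint δ K k ∧ s'.rarr 2 k = optCost B (gridPoint δ K k) T ∧
      s'.rarr 3 k = 1) := by
  refine (Runs.forLoop (m := K + 1) (m' := K + 1) (c := 64 * T) (fun j s' => ∀ k < j,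
      s'.rarr 1 k = gridPoint δ K k ∧ s'.rarr 2 k = optCost B (gridPoint δ K k) T ∧
      s'.rarr 3 k = 1)
    (by simp) le_rfl (by omega) rfl (fun s' h => ?_) (fun _ _ _ h => h) ?_ le_rfl).mono ?_ ?_
  · rw [NExp.eval, NExp.eval, NExp.eval, h.nreg 1 rfl, hK]
  · intro j hj s' hf hv hI
    refine Runs.seq (a := 14) (b := 40 * T + 10) (Q := fun s'' => s''.rarr 1 =
      Function.update (s'.rarr 1) j (gridPoint δ K j)) (Runs.setRArr ?_ (by decide)) ?_
    · simp only [Function.update_self, RExp.eval, NExp.eval, hv, hf.rreg 1 rfl, hδ,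
        hf.nreg 1 rfl, hK, gridPoint, Nat.cast_one]
    intro s₁ hf₁ h₁
    refine Runs.seq (a := 3) (b := 40 * T + 7) (Q := fun s'' => s''.rreg 5 = 0)
      (Runs.setRReg (by simp [RExp.eval, NExp.eval]) (by decide)) ?_
    intro s₂ hf₂ h₂
    have e1 : ∀ s₃ : State, s₃.rarr 1 = s₂.rarr 1 → s₃.nreg 7 = s₂.nreg 7 →
        s₃.rarr 1 (s₃.nreg 7) = gridPoint δ K j := by
      intro s₃ h h'
      rw [h, h', hf₂.rarr 1 rfl, hf₂.nreg 7 rfl, h₁, hf₁.nreg 7 rfl, hv, Function.update_self]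
    refine Runs.seq (a := 40 * T) (b := 7) ((Runs.forLoop (m := T) (m' := T) (c := 26)
      (fun n s'' => s''.rreg 5 = optCost B (gridPoint δ K j) n)
      h₂ le_rfl hT rfl (fun s' h => ?_) (fun _ _ _ h => h) ?_ le_rfl).mono ?_
        (fun _ _ h => h)) ?_
    · rw [NExp.eval, h.nreg 0 rfl, hf₂.nreg 0 rfl, hf₁.nreg 0 rfl, hf.nreg 0 rfl, h0]
    · intro n hn s₃ hf₃ hv₃ hI₃
      have e2 := e1 s₃ (hf₃.rarr 1 rfl) (hf₃.nreg 7 rfl)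
      have eB : s₃.rreg 0 = B := by
        rw [hf₃.rreg 0 rfl, hf₂.rreg 0 rfl, hf₁.rreg 0 rfl, hf.rreg 0 rfl, hB]
      refine Runs.cond (m := 16) (fun hb => ?_) (fun hb => ?_) (by decide)
      · simp only [BExp.holds, RExp.eval, NExp.eval, e2, eB, hI₃, Nat.cast_one] at hb
        refine Runs.setRReg ?_ (by decide)
        simp only [Function.update_self, RExp.eval, NExp.eval, e2, eB, hI₃, Nat.cast_one,
          optCost, min_eq_left hb.le]
      · simp only [BExp.holds, RExp.eval, NExp.eval, e2, eB, hI₃, Nat.cast_one, not_lt] at hb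
        refine Runs.setRReg ?_ (by decide)
        simp only [Function.update_self, RExp.eval, NExp.eval, e2, hI₃, Nat.cast_one,
          optCost, min_eq_right hb]
    · simp only [NExp.time]
      omega
    · intro s₃ hf₃ h₃
      have ej : s₃.nreg 7 = j := by
        rw [hf₃.nreg 7 rfl, hf₂.nreg 7 rfl, hf₁.nreg 7 rfl, hv]
      refine Runs.seq (a := 3) (b := 4) (Q := fun s'' => s''.rarr 2 =
        Function.update (s₃.rarr 2) j (optCost B (gridPoint δ K j) T))
        (Runs.setRArr ?_ (by decide)) ?_
      · simp only [Function.update_self, RExp.eval, NExp.eval, h₃, ej]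
      intro s₄ hf₄ h₄
      refine Runs.setRArr ?_ (by decide)
      intro k hk
      have e3 : s₄.rarr 1 k = Function.update (s'.rarr 1) j (gridPoint δ K j) k := by
        rw [hf₄.rarr 1 rfl, hf₃.rarr 1 rfl, hf₂.rarr 1 rfl, h₁]
      have e4 : s₄.rarr 2 k =
          Function.update (s'.rarr 2) j (optCost B (gridPoint δ K j) T) k := by
        rw [h₄, hf₃.rarr 2 rfl, hf₂.rarr 2 rfl, hf₁.rarr 2 rfl]
      have e5 : s₄.rarr 3 = s'.rarr 3 := by
        rw [hf₄.rarr 3 rfl, hf₃.rarr 3 rfl, hf₂.rarr 3 rfl, hf₁.rarr 3 rfl]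
      have e6 : s₄.nreg 7 = j := (hf₄.nreg 7 rfl).trans ej
      have n1 : (1 : ℕ) ≠ 3 := by decide
      have n2 : (2 : ℕ) ≠ 3 := by decide
      simp only [Function.update_of_ne n1, Function.update_of_ne n2, Function.update_self,
        NExp.eval, RExp.eval, e3, e4, e5, e6]
      by_cases h : k = j
      · subst h
        simp
      · simp only [Function.update_of_ne h]
        exact hI k (by omega)
  · simp only [NExp.time]
    nlinarith
  · intro s' _ h k hk
    exact h k (by omega)

/-- The fourth power of the number of days. -/
def daysPowExp : NExp := .mul (.mul (.reg 0) (.reg 0)) (.mul (.reg 0) (.reg 0))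

/-- The precision, the size of the grid, the number of rounds and the learning rate. -/
def parameterProgram : Program :=
  .seq (.setNReg 2 (.const 1))
    (.seq (.loop (.rlt (.mul (.ofNat (.reg 2)) (.reg 2)) (.ofNat (.const 1)))
        (.setNReg 2 (.add (.reg 2) (.const 1))))
      (.seq (.setNReg 1 (.mul (.mul (.const 8) daysPowExp) (.reg 2)))
        (.seq (.setNReg 5 (.const 1))
          (.seq (.setNReg 4 (.const 0))
            (.seq (.loop (.nlt (.reg 5) (.add (.reg 1) (.const 1)))
                (.seq (.setNReg 5 (.mul (.reg 5) (.const 2)))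
                  (.setNReg 4 (.add (.reg 4) (.const 1)))))
              (.seq (.setNReg 6 (.mul (.mul (.mul (.const 16) daysPowExp)
                  (.mul (.reg 2) (.reg 2))) (.reg 4)))
                (.setRReg 3 (.div (.ofNat (.const 1)) (.mul (.mul (.ofNat (.const 4))
                  (.ofNat daysPowExp)) (.ofNat (.reg 2)))))))))))

/-- A natural number that is at least one and at least `1 / ε`. -/
noncomputable def precision (ε : ℝ) : ℕ := max 1 ⌈ε⁻¹⌉₊

/-- Reals cannot be rounded, so `M` is found by counting up until `M * ε ≥ 1`, and `L` by doubling
until the grid size is reached. These searches take `O(M)` and `O(L)` steps. -/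
theorem runs_parameterProgram {T M K L : ℕ} {ε : ℝ} {s : State} (hε : 0 < ε)
    (h0 : s.nreg 0 = T) (hsε : s.rreg 2 = ε) (hM : M = precision ε)
    (hK : K = 8 * T ^ 4 * M) (hL : L = Nat.clog 2 (K + 1)) :
    Runs parameterProgram s (12 * M + 14 * L + 100) (fun s' => s'.nreg 1 = K ∧
      s'.nreg 6 = 16 * T ^ 4 * M ^ 2 * L ∧ s'.rreg 3 = 1 / (4 * (T : ℝ) ^ 4 * M)) := by
  have hM1 : 1 ≤ M := by rw [hM]; exact le_max_left _ _
  have epow : ∀ s' : State, s'.nreg 0 = T → daysPowExp.eval s' = T ^ 4 := by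
    intro s' h
    simp only [daysPowExp, NExp.eval, h]
    ring
  refine Runs.seq (a := 2) (b := 12 * M + 14 * L + 98) (Q := fun s' => s'.nreg 2 = 1 + 0)
    (Runs.setNReg (by simp [NExp.eval]) (by decide)) ?_
  intro s₁ hf₁ h₁
  refine Runs.seq (a := 12 * M + 8) (b := 14 * L + 90) (Q := fun s' => s'.nreg 2 = M)
    -- The counter starts at one, hence `M - 1` iterations; this also yields `M = 1` for `ε ≥ 1`.
    ((Runs.loop (m := M - 1) (c := 4) (fun j s' => s'.nreg 2 = 1 + j) h₁ ?_ ?_).mono ?_ ?_) ?_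
  · intro j hj s' hf hI
    refine ⟨?_, Runs.setNReg ?_ (by decide)⟩
    · simp only [BExp.holds, RExp.eval, NExp.eval, hI, hf.rreg 2 rfl, hf₁.rreg 2 rfl, hsε]
      have h2 : 1 + j < ⌈ε⁻¹⌉₊ := by
        rcases le_total ⌈ε⁻¹⌉₊ 1 with h | h
        · rw [hM, precision, max_eq_left h] at hj
          omega
        · rw [hM, precision, max_eq_right h] at hj
          omega
      have h3 := Nat.lt_ceil.1 h2
      rw [inv_eq_one_div, lt_div_iff₀ hε] at h3
      simpa using h3
    · simp only [Function.update_self, NExp.eval, hI]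
      ring
  · intro s' hf hI
    simp only [BExp.holds, RExp.eval, NExp.eval, hI, hf.rreg 2 rfl, hf₁.rreg 2 rfl, hsε, not_lt]
    have h2 : ⌈ε⁻¹⌉₊ ≤ 1 + (M - 1) := by
      have : ⌈ε⁻¹⌉₊ ≤ M := by rw [hM]; exact le_max_right _ _
      omega
    have h3 := Nat.ceil_le.1 h2
    rw [inv_eq_one_div, div_le_iff₀ hε] at h3
    simpa using h3
  · simp only [BExp.time, RExp.time, NExp.time]
    omega
  · intro s' _ h
    rw [h]
    omega
  intro s₂ hf₂ h₂
  have e0 : s₂.nreg 0 = T := by rw [hf₂.nreg 0 rfl, hf₁.nreg 0 rfl, h0]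
  refine Runs.seq (a := 14) (b := 14 * L + 76) (Q := fun s' => s'.nreg 1 = K)
    (Runs.setNReg ?_ (by decide)) ?_
  · simp only [Function.update_self, NExp.eval, epow s₂ e0, h₂, hK]
  intro s₃ hf₃ h₃
  refine Runs.seq (a := 2) (b := 14 * L + 74) (Q := fun s' => s'.nreg 5 = 2 ^ 0)
    (Runs.setNReg (by simp [NExp.eval]) (by decide)) ?_
  intro s₄ hf₄ h₄
  refine Runs.seq (a := 2) (b := 14 * L + 72) (Q := fun s' => s'.nreg 5 = 2 ^ 0 ∧ s'.nreg 4 = 0)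
    (Runs.setNReg (by simp [NExp.eval, h₄]) (by decide)) ?_
  intro s₅ hf₅ h₅
  have e1 : s₅.nreg 1 = K := by rw [hf₅.nreg 1 rfl, hf₄.nreg 1 rfl, h₃]
  refine Runs.seq (a := 14 * L + 6) (b := 66) (Q := fun s' => s'.nreg 4 = L)
    ((Runs.loop (m := L) (c := 8) (fun j s' => s'.nreg 5 = 2 ^ j ∧ s'.nreg 4 = j) h₅ ?_ ?_).mono
      ?_ fun _ _ h => h.2) ?_
  · intro j hj s' hf hI
    refine ⟨?_, Runs.seq (a := 4) (b := 4) (Q := fun s'' => s''.nreg 5 = 2 ^ (j + 1))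
      (Runs.setNReg ?_ (by decide)) ?_⟩
    · simp only [BExp.holds, NExp.eval, hI.1, hf.nreg 1 rfl, e1]
      rw [hL] at hj
      exact (Nat.lt_clog_iff_pow_lt (by decide)).1 hj
    · simp only [Function.update_self, NExp.eval, hI.1, pow_succ]
    · intro s'' hf' h'
      refine Runs.setNReg ⟨?_, ?_⟩ (by decide)
      · have n1 : (5 : ℕ) ≠ 4 := by decide
        simp only [Function.update_of_ne n1, h']
      · simp only [Function.update_self, NExp.eval, hf'.nreg 4 rfl, hI.2]
  · intro s' hf hI
    simp only [BExp.holds, NExp.eval, hI.1, hf.nreg 1 rfl, e1, not_lt]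
    rw [hL]
    exact Nat.le_pow_clog (by decide) _
  · simp only [BExp.time, NExp.time]
    omega
  intro s₆ hf₆ h₆
  have e0' : s₆.nreg 0 = T := by
    rw [hf₆.nreg 0 rfl, hf₅.nreg 0 rfl, hf₄.nreg 0 rfl, hf₃.nreg 0 rfl, e0]
  have e2 : s₆.nreg 2 = M := by
    rw [hf₆.nreg 2 rfl, hf₅.nreg 2 rfl, hf₄.nreg 2 rfl, hf₃.nreg 2 rfl, h₂]
  refine Runs.seq (a := 33) (b := 33) (Q := fun s' => s'.nreg 6 = 16 * T ^ 4 * M ^ 2 * L)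
    (Runs.setNReg ?_ (by decide)) ?_
  · simp only [Function.update_self, NExp.eval, epow s₆ e0', h₆, e2]
    ring
  intro s₇ hf₇ h₇
  refine Runs.setRReg ⟨?_, h₇, ?_⟩ (by decide)
  · exact ((hf₇.nreg 1 rfl).trans (hf₆.nreg 1 rfl)).trans e1
  · simp only [Function.update_self, RExp.eval, NExp.eval,
      epow s₇ ((hf₇.nreg 0 rfl).trans e0'), hf₇.nreg 2 rfl, e2]
    push_cast
    ring


theorem runs_responseProgram_grid {T K t : ℕ} {B δ : ℝ} {s : State} {W : ℕ → ℝ} (hT : 1 ≤ T)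
    (hδ : 0 < δ) (hδ1 : δ ≤ 1) (h0 : s.nreg 0 = T) (hsK : s.nreg 1 = K) (hst : s.nreg 8 = t)
    (hB : s.rreg 0 = B) (h1 : ∀ k ≤ K, s.rarr 1 k = gridPoint δ K k)
    (h2 : ∀ k ≤ K, s.rarr 2 k = optCost B (gridPoint δ K k) T) (h3 : ∀ k ≤ K, s.rarr 3 k = W k) :
    Runs responseProgram s (176 * ((K + 1) * T * T * T)) (fun s' =>
      (∀ i < T, ∀ g ≤ i, s'.narr 0 (tableCell T t i g) = (responseTable T B δ K W i g).toNat) ∧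
      ∀ q, (∀ i < T, ∀ g ≤ i, q ≠ tableCell T t i g) → s'.narr 0 q = s.narr 0 q) := by
  set p : Fin (K + 1) → ℝ := fun k => gridPoint δ K k with hp
  set v : Fin (K + 1) → ℝ := fun k => W k / (optCost B (gridPoint δ K k) T * gridPoint δ K k)
    with hv
  have hS : ∀ i g, responseTable T B δ K W i g = decide (B * ∑ k, posterior p v i g k * p k <
      ∑ k, posterior p v i g k * p k +
        bayesValue B p (T - (i + 1)) (posterior p v (i + 1) (g + 1))) := fun _ _ => rfl
  refine runs_responseProgram (mass := fun i g => ∑ k, posterior p v i g k * p k)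
    (V := fun i g => bayesValue B p (T - i) (posterior p v i g))
    hT h0 hsK hst hB ?_ (fun i _ g _ => hS i g) ?_ ?_
  · intro i _ g _
    rw [Finset.sum_range]
    refine Finset.sum_congr rfl fun k _ => ?_
    have hk : (k : ℕ) ≤ K := Nat.lt_succ_iff.1 k.isLt
    have := (gridPoint_pos (K := K) hδ hδ1 k).ne'
    rw [h1 k hk, h2 k hk, h3 k hk, posterior, hp, hv]
    -- The prior contains `1 / p` and the mass of a good day a factor `p`; they cancel, which is why
    -- the program divides by `optCost` alone.
    field_simp
  · intro i hi g hg
    have e : T - i = T - (i + 1) + 1 := by omega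
    simp only [e, bayesValue_posterior_succ _ _ _ _ hg]
    by_cases h : responseTable T B δ K W i g = true
    · have h' := h
      rw [hS, decide_eq_true_iff] at h'
      rw [if_pos h, min_eq_left h'.le]
    · have h' := h
      rw [hS, decide_eq_true_iff, not_lt] at h'
      rw [if_neg h, min_eq_right h']
  · intro g
    simp [bayesValue]

section Round
variable {T K N t : ℕ} {B δ η : ℝ} {s : State}

theorem runs_roundProgram (hT : 1 ≤ T) (hδ : 0 < δ) (hδ1 : δ ≤ 1) (h0 : s.nreg 0 = T)
    (hsK : s.nreg 1 = K) (hst : s.nreg 8 = t) (hsN : s.nreg 6 = N) (hB : s.rreg 0 = B)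
    (hsη : s.rreg 3 = η) (h1 : ∀ k ≤ K, s.rarr 1 k = gridPoint δ K k)
    (h2 : ∀ k ≤ K, s.rarr 2 k = optCost B (gridPoint δ K k) T)
    (h3 : ∀ k ≤ K, s.rarr 3 k = gridWeight T B δ K η t k) :
    Runs roundProgram s (336 * ((K + 1) * T * T * T)) (fun s' =>
      s'.rarr 0 = Function.update (s.rarr 0) t (1 / (N : ℝ)) ∧
      (∀ k ≤ K, s'.rarr 3 k = gridWeight T B δ K η (t + 1) k) ∧
      (∀ i < T, ∀ g ≤ i, s'.narr 0 (tableCell T t i g) = (roundTable T B δ K η t i g).toNat) ∧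
      ∀ q, (∀ i < T, ∀ g ≤ i, q ≠ tableCell T t i g) → s'.narr 0 q = s.narr 0 q) := by
  have hA : 1 ≤ (K + 1) * (T * T) := Nat.mul_pos (by omega) (Nat.mul_pos hT hT)
  have hA' : (K + 1) * (T * T) ≤ (K + 1) * T * T * T := by
    rw [← mul_assoc]
    exact Nat.le_mul_of_pos_right _ hT
  refine Runs.seq (a := 7)
    (b := 176 * ((K + 1) * T * T * T) + 153 * ((K + 1) * (T * T)))
    (Q := fun s' => s'.rarr 0 = Function.update (s.rarr 0) t (1 / (N : ℝ)))
    (Runs.setRArr ?_ (by decide)) ?_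
  · simp only [Function.update_self, RExp.eval, NExp.eval, hst, hsN, Nat.cast_one]
  intro s₁ hf₁ h₁
  refine Runs.seq (a := 176 * ((K + 1) * T * T * T)) (b := 153 * ((K + 1) * (T * T)))
    (runs_responseProgram_grid (W := gridWeight T B δ K η t) hT hδ hδ1
      ((hf₁.nreg 0 rfl).trans h0) ((hf₁.nreg 1 rfl).trans hsK) ((hf₁.nreg 8 rfl).trans hst)
      ((hf₁.rreg 0 rfl).trans hB) (by rwa [hf₁.rarr 1 rfl]) (by rwa [hf₁.rarr 2 rfl])
      (by rwa [hf₁.rarr 3 rfl])) ?_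
  intro s₂ hf₂ h₂
  refine (Runs.forLoop (m := K + 1) (m' := K + 1) (c := 135 * (T * T)) (fun j s' =>
      (∀ k < j, s'.rarr 3 k = gridWeight T B δ K η (t + 1) k) ∧
      ∀ k, j ≤ k → s'.rarr 3 k = s.rarr 3 k)
    ⟨by simp, fun k _ => by rw [hf₂.rarr 3 rfl, hf₁.rarr 3 rfl]⟩ le_rfl (by omega) rfl
    (fun s' h => ?_) (fun _ _ _ h => h) ?_ le_rfl).mono ?_ ?_
  · rw [NExp.eval, NExp.eval, NExp.eval, h.nreg 1 rfl, hf₂.nreg 1 rfl, hf₁.nreg 1 rfl, hsK]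
  · intro j hj s' hf hv hI
    have hjK : j ≤ K := by omega
    refine (runs_evaluationProgram (T := T) (t := t) (k := j) (B := B) (p := gridPoint δ K j)
      (S := roundTable T B δ K η t) hT
      (by rw [hf.nreg 0 rfl, hf₂.nreg 0 rfl, hf₁.nreg 0 rfl, h0])
      (by rw [hf.nreg 8 rfl, hf₂.nreg 8 rfl, hf₁.nreg 8 rfl, hst]) hv
      (by rw [hf.rreg 0 rfl, hf₂.rreg 0 rfl, hf₁.rreg 0 rfl, hB])
      (by rw [hf.rarr 1 rfl, hf₂.rarr 1 rfl, hf₁.rarr 1 rfl, h1 j hjK]) ?_).mono le_rfl ?_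
    · intro i hi g hg
      rw [hf.narr 0 rfl]
      exact h₂.1 i hi g hg
    · intro s'' _ u
      refine ⟨fun k hk => ?_, fun k hk => ?_⟩
      · rw [u]
        by_cases h : k = j
        · subst h
          rw [Function.update_self, hI.2 k le_rfl, h3 k hjK, hf.rarr 2 rfl, hf₂.rarr 2 rfl,
            hf₁.rarr 2 rfl, h2 k hjK, hf.rreg 3 rfl, hf₂.rreg 3 rfl, hf₁.rreg 3 rfl, hsη]
          rfl
        · rw [Function.update_of_ne h, hI.1 k (by omega)]
      · rw [u, Function.update_of_ne (by omega), hI.2 k (by omega)]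
  · simp only [NExp.time]
    have : 1 ≤ T * T := Nat.mul_pos hT hT
    nlinarith
  · intro s' hf hI
    refine ⟨?_, fun k hk => hI.1 k (by omega), ?_, ?_⟩
    · rw [hf.rarr 0 rfl, hf₂.rarr 0 rfl, h₁]
    · rw [hf.narr 0 rfl]
      exact h₂.1
    · rw [hf.narr 0 rfl]
      rw [hf₁.narr 0 rfl] at h₂
      exact h₂.2

end Round

/-- The whole program. -/
def approximationProgram : Program :=
  .seq parameterProgram
    (.seq gridProgram (.seq (forLoop 8 (.reg 6) roundProgram) (.setNReg 0 (.reg 6))))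

theorem runs_approximationProgram {T M K L N : ℕ} {B δ ε η : ℝ} (hT : 1 ≤ T) (hδ : 0 < δ)
    (hδ1 : δ ≤ 1) (hε : 0 < ε) (hM : M = precision ε) (hK : K = 8 * T ^ 4 * M)
    (hL : L = Nat.clog 2 (K + 1)) (hN : N = 16 * T ^ 4 * M ^ 2 * L) (hNpos : 1 ≤ N)
    (hη : η = 1 / (4 * (T : ℝ) ^ 4 * M)) :
    Runs approximationProgram (inputState T B δ ε)
      (12 * M + 14 * L + 102 + 82 * ((K + 1) * T) + N * (350 * ((K + 1) * T * T * T)))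
      (fun s => s.nreg 0 = N ∧ (∀ n < N, s.rarr 0 n = 1 / (N : ℝ)) ∧ (∀ q, s.narr 0 (2 * q) = 0) ∧
        ∀ n < N, ∀ i < T, ∀ g ≤ i,
          s.narr 0 (tableCell T n i g) = (roundTable T B δ K η n i g).toNat) := by
  have hA : 1 ≤ (K + 1) * T * T * T :=
    Nat.mul_pos (Nat.mul_pos (Nat.mul_pos (by omega) hT) hT) hT
  refine Runs.seq (a := 12 * M + 14 * L + 100)
    (b := 2 + 82 * ((K + 1) * T) + N * (350 * ((K + 1) * T * T * T)))
    (runs_parameterProgram (T := T) hε rfl rfl hM hK hL) ?_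
  rintro s₁ hf₁ ⟨p1, p2, p3⟩
  rw [← hN] at p2
  rw [← hη] at p3
  have q0 : s₁.nreg 0 = T := hf₁.nreg 0 rfl
  have qB : s₁.rreg 0 = B := hf₁.rreg 0 rfl
  refine Runs.seq (a := 82 * ((K + 1) * T)) (b := 2 + N * (350 * ((K + 1) * T * T * T)))
    (runs_gridProgram (B := B) (δ := δ) hT q0 p1 qB (hf₁.rreg 1 rfl)) ?_
  intro s₂ hf₂ h₂
  refine Runs.seq (a := N * (350 * ((K + 1) * T * T * T))) (b := 2)
    ((Runs.forLoop (m := N) (m' := N) (c := 336 * ((K + 1) * T * T * T)) (fun t s' =>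
      (∀ k ≤ K, s'.rarr 3 k = gridWeight T B δ K η t k) ∧
      (∀ n < t, s'.rarr 0 n = 1 / (N : ℝ)) ∧ (∀ q, s'.narr 0 (2 * q) = 0) ∧
      ∀ n < t, ∀ i < T, ∀ g ≤ i,
        s'.narr 0 (tableCell T n i g) = (roundTable T B δ K η n i g).toNat)
    ⟨fun k hk => (h₂ k hk).2.2, by simp, fun q => ?_, by simp⟩ le_rfl hNpos rfl
    (fun s' h => ?_) (fun _ _ _ h => h) ?_ le_rfl).mono ?_ fun _ _ h => h) ?_
  · rw [hf₂.narr 0 rfl, hf₁.narr 0 rfl]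
    rfl
  · rw [NExp.eval, h.nreg 6 rfl, hf₂.nreg 6 rfl, p2]
  · rintro t ht s' hf hv ⟨i1, i2, i3, i4⟩
    refine (runs_roundProgram (T := T) (K := K) (N := N) (t := t) (B := B) (η := η) hT hδ hδ1
      (by rw [hf.nreg 0 rfl, hf₂.nreg 0 rfl, q0])
      (by rw [hf.nreg 1 rfl, hf₂.nreg 1 rfl, p1]) hv
      (by rw [hf.nreg 6 rfl, hf₂.nreg 6 rfl, p2])
      (by rw [hf.rreg 0 rfl, hf₂.rreg 0 rfl, qB])
      (by rw [hf.rreg 3 rfl, hf₂.rreg 3 rfl, p3])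
      (fun k hk => by rw [hf.rarr 1 rfl, (h₂ k hk).1])
      (fun k hk => by rw [hf.rarr 2 rfl, (h₂ k hk).2.1]) i1).mono le_rfl ?_
    rintro s'' - ⟨u1, u2, u3, u4⟩
    refine ⟨u2, fun n hn => ?_, fun q => ?_, fun n hn i hi g hg => ?_⟩
    · rw [u1]
      by_cases h : n = t
      · rw [h, Function.update_self]
      · rw [Function.update_of_ne h, i2 n (by omega)]
    · rw [u4, i3]
      intro i _ g _ e
      unfold tableCell at e
      omega
    · by_cases h : n = t
      · subst h
        exact u3 i hi g hg
      · rw [u4, i4 n (by omega) i hi g hg]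
        intro i' hi' g' hg' e
        exact h (tableCell_inj hi (by omega) hi' (by omega) e).1
  · simp only [NExp.time]
    exact Nat.mul_le_mul_left _ (by omega)
  · rintro s₃ hf₃ ⟨-, i2, i3, i4⟩
    refine Runs.setNReg ⟨?_, i2, i3, i4⟩ (by decide)
    simp only [Function.update_self, NExp.eval, hf₃.nreg 6 rfl, hf₂.nreg 6 rfl, p2]

/-- Bad-day decisions occupy the even cells. The program writes to odd cells only, so the initial
zeros there already say "continue". -/
theorem outputAlg_toDet {T n : ℕ} {s : State} {S : ℕ → ℕ → Bool}
    (h0 : ∀ q, s.narr 0 (2 * q) = 0)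
    (h1 : ∀ i < T, ∀ g ≤ i, s.narr 0 (tableCell T n i g) = (S i g).toNat) :
    (outputAlg T s n).toDet = tableAlg T S := by
  funext i h
  simp only [InfoSymAlg.toDet, outputAlg, tableAlg]
  have hg : (goodBefore h).val ≤ i.val := Nat.lt_succ_iff.1 (goodBefore h).isLt
  cases h (Fin.last i.val)
  · have e := h0 ((n * T + i.val) * T + (goodBefore h).val)
    rw [mul_comm] at e
    simp [e]
  · have e := h1 i.val i.isLt _ hg
    unfold tableCell at e
    rw [Bool.toNat_true, e]
    cases S i.val (goodBefore h).val <;> simp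

/-! ### The running time -/

theorem precision_le {ε : ℝ} (hε : 0 < ε) : (precision ε : ℝ) ≤ 2 * max 1 ε⁻¹ := by
  have h1 : (1 : ℝ) ≤ max 1 ε⁻¹ := le_max_left _ _
  have h2 : ε⁻¹ ≤ max 1 ε⁻¹ := le_max_right _ _
  have h3 := Nat.ceil_lt_add_one (inv_pos.2 hε).le
  rw [precision, Nat.cast_max, Nat.cast_one]
  exact max_le (by linarith) (by linarith)

theorem one_le_precision_mul {ε : ℝ} (hε : 0 < ε) : 1 ≤ precision ε * ε := by
  have h1 : ε⁻¹ ≤ precision ε :=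
    (Nat.le_ceil _).trans (by exact_mod_cast le_max_right _ _)
  rwa [inv_eq_one_div, div_le_iff₀ hε] at h1

/-- From `2 ^ (clog 2 n - 1) < n ≤ x ^ 8` and `log 2 ≥ 1 / 2` one gets `clog 2 n ≤ 16 * log x + 1`;
the hypothesis `1 ≤ log x` absorbs the one. -/
theorem clog_two_le {n : ℕ} {x : ℝ} (hn : 1 < n) (h : (n : ℝ) ≤ x ^ 8)
    (hlog : 1 ≤ Real.log x) : (Nat.clog 2 n : ℝ) ≤ 17 * Real.log x := by
  have hc : 0 < Nat.clog 2 n := Nat.clog_pos (by decide) hn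
  have h1 : 2 ^ (Nat.clog 2 n).pred < n := Nat.pow_pred_clog_lt_self (by decide) hn
  have h2 : ((2 : ℝ) ^ (Nat.clog 2 n).pred) < n := by exact_mod_cast h1
  have h3 := Real.log_le_log (by positivity) (h2.le.trans h)
  rw [Real.log_pow, Real.log_pow] at h3
  have h4 : ((Nat.clog 2 n).pred : ℝ) = Nat.clog 2 n - 1 := by
    rw [Nat.pred_eq_sub_one, Nat.cast_sub hc, Nat.cast_one]
  have h5 : (1 / 2 : ℝ) ≤ Real.log 2 := by linarith [Real.log_two_gt_d9]
  have h6 : (0 : ℝ) ≤ (Nat.clog 2 n).pred := Nat.cast_nonneg _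
  push_cast at h3
  nlinarith

/-- All variables in the target monomial are at least one, so each term is dominated separately. The
rounds dominate with `6473600 * T ^ 11 * m ^ 3 * ℓ`; the exponent `12` leaves a factor `T` to spare.
-/
theorem steps_le {T m M L K N ℓ : ℝ} (hT : 1 ≤ T) (hm : 1 ≤ m) (hℓ : 1 ≤ ℓ) (hM0 : 0 ≤ M)
    (hM : M ≤ 2 * m) (hL0 : 0 ≤ L) (hL : L ≤ 17 * ℓ) (hK : K = 8 * T ^ 4 * M)
    (hN : N = 16 * T ^ 4 * M ^ 2 * L) :
    12 * M + 14 * L + 102 + 82 * ((K + 1) * T) + N * (350 * ((K + 1) * T * T * T)) ≤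
      10 ^ 7 * T ^ 12 * m ^ 3 * ℓ ^ 1 := by
  have key : ∀ a b c : ℕ, a ≤ 12 → b ≤ 3 → c ≤ 1 →
      T ^ a * m ^ b * ℓ ^ c ≤ T ^ 12 * m ^ 3 * ℓ ^ 1 := by
    intro a b c ha hb hc
    gcongr
  have x0 := key 0 0 0 (by decide) (by decide) (by decide)
  have x1 := key 0 1 0 (by decide) (by decide) (by decide)
  have x2 := key 0 0 1 (by decide) (by decide) (by decide)
  have x3 := key 5 1 0 (by decide) (by decide) (by decide)
  have x4 := key 11 3 1 (by decide) (by decide) (by decide)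
  simp only [pow_zero, one_mul, mul_one, pow_one] at x0 x1 x2 x3 x4
  have hK1 : K + 1 ≤ 17 * T ^ 4 * m := by
    have h1 : 1 ≤ T ^ 4 * m := one_le_mul_of_one_le_of_one_le (one_le_pow₀ hT) hm
    have h2 : 8 * T ^ 4 * M ≤ 8 * T ^ 4 * (2 * m) := by gcongr
    rw [hK]
    linarith
  have hK0 : 0 ≤ K + 1 := by rw [hK]; positivity
  have hNle : N ≤ 16 * T ^ 4 * (2 * m) ^ 2 * (17 * ℓ) := by rw [hN]; gcongr
  have a1 : (K + 1) * T ≤ 17 * T ^ 4 * m * T := by gcongr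
  have a2 : N * (350 * ((K + 1) * T * T * T)) ≤
      16 * T ^ 4 * (2 * m) ^ 2 * (17 * ℓ) * (350 * (17 * T ^ 4 * m * T * T * T)) := by
    gcongr
  have e2 : 16 * T ^ 4 * (2 * m) ^ 2 * (17 * ℓ) * (350 * (17 * T ^ 4 * m * T * T * T)) =
      6473600 * (T ^ 11 * m ^ 3 * ℓ) := by ring
  have e1 : 17 * T ^ 4 * m * T = 17 * (T ^ 5 * m) := by ring
  rw [e1] at a1
  rw [e2] at a2
  have e3 : 10 ^ 7 * T ^ 12 * m ^ 3 * ℓ ^ 1 = 10 ^ 7 * (T ^ 12 * m ^ 3 * ℓ) := by ring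
  rw [e3]
  linarith

end SkiRental

theorem theoremt :
    ∃ (P : RealRAM.Program) (C : ℝ) (c : ℕ),
      ∀ (T : ℕ) (B δ ε : ℝ), 1 ≤ T → 1 < B → 0 < δ → δ ≤ 1 → 0 < ε →
        ∃ (t : ℕ) (s : RealRAM.State) (σ : SkiRental.DetAlg T → ℝ),
          RealRAM.Exec P (SkiRental.inputState T B δ ε) t s ∧
          SkiRental.OutputsAlg T s σ ∧
          SkiRental.IsApproxOptimal B δ ε σ ∧
          (t : ℝ) ≤ C * (T : ℝ) ^ 12 * (max 1 ε⁻¹) ^ 3 *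
            Real.log (2 + (T : ℝ) * max 1 ε⁻¹) ^ c := by
  refine ⟨SkiRental.approximationProgram, 10 ^ 7, 1, fun T B δ ε hT hB hδ hδ1 hε => ?_⟩
  obtain ⟨M, hM⟩ : ∃ M, M = SkiRental.precision ε := ⟨_, rfl⟩
  obtain ⟨K, hK⟩ : ∃ K, K = 8 * T ^ 4 * M := ⟨_, rfl⟩
  obtain ⟨L, hL⟩ : ∃ L, L = Nat.clog 2 (K + 1) := ⟨_, rfl⟩
  obtain ⟨N, hN⟩ : ∃ N, N = 16 * T ^ 4 * M ^ 2 * L := ⟨_, rfl⟩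
  obtain ⟨η, hη⟩ : ∃ η, η = 1 / (4 * (T : ℝ) ^ 4 * M) := ⟨_, rfl⟩
  have hM1 : 1 ≤ M := by rw [hM]; exact le_max_left _ _
  have hKpos : 0 < K := by rw [hK]; positivity
  have hLpos : 0 < L := by rw [hL]; exact Nat.clog_pos (by decide) (by omega)
  have hNpos : 1 ≤ N := by rw [hN]; exact Nat.succ_le_of_lt (by positivity)
  have hN' : (N : ℝ) ≠ 0 := by exact_mod_cast (by omega : N ≠ 0)
  obtain ⟨t, s, hexec, ht, s0, s1, s2, s3⟩ :=
    SkiRental.runs_approximationProgram (B := B) hT hδ hδ1 hε hM hK hL hN hNpos hη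
  refine ⟨t, s, fun A => ∑ n ∈ Finset.range N,
    if SkiRental.tableAlg T (SkiRental.roundTable T B δ K η n) = A then 1 / (N : ℝ) else 0,
    hexec, ⟨?_, ?_, ?_⟩, ?_, ?_⟩
  · intro n hn
    rw [s1 n (by omega)]
    positivity
  · rw [s0, Finset.sum_congr rfl fun n hn => s1 n (Finset.mem_range.1 hn)]
    simp [hN']
  · intro A
    rw [s0]
    refine Finset.sum_congr rfl fun n hn => ?_
    have hn := Finset.mem_range.1 hn
    rw [SkiRental.outputAlg_toDet s2 (s3 n hn), s1 n hn]
  · refine SkiRental.isApproxOptimal_uniform_roundTable hT hB.le hδ hδ1 hM1 ?_ hK ?_ hN hη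
      fun _ => rfl
    · rw [hM]
      exact SkiRental.one_le_precision_mul hε
    · rw [hL]
      exact Nat.le_pow_clog (by decide) _
  · have hT' : (1 : ℝ) ≤ T := by exact_mod_cast hT
    set m : ℝ := max 1 ε⁻¹ with hm
    have hm1 : 1 ≤ m := le_max_left _ _
    have hMm : (M : ℝ) ≤ 2 * m := by rw [hM]; exact SkiRental.precision_le hε
    have hTm : 1 ≤ T * m := one_le_mul_of_one_le_of_one_le hT' hm1
    have hlog : 1 ≤ Real.log (2 + T * m) := by
      -- The argument `2 + T * m` is at least `3`, hence exceeds `e`.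
      rw [Real.le_log_iff_exp_le (by linarith)]
      linarith [Real.exp_one_lt_three]
    -- With `T * m ≥ 1`, `K + 1` is at most `17 * (T * m) ^ 4`. The constant `17` is below `3 ^ 4`,
    -- and both `3` and `T * m` are at most `2 + T * m`, whence the eighth power.
    have hK8 : ((K + 1 : ℕ) : ℝ) ≤ (2 + T * m) ^ 8 := by
      have h1 : (K : ℝ) ≤ 8 * T ^ 4 * (2 * m) := by
        rw [hK]
        push_cast
        gcongr
      have h2 : (T : ℝ) ^ 4 * m ≤ (T * m) ^ 4 := by
        rw [mul_pow]
        gcongr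
        exact le_self_pow₀ hm1 (by decide)
      have h3 : (1 : ℝ) ≤ (T * m) ^ 4 := one_le_pow₀ hTm
      have h4 : (3 : ℝ) ^ 4 ≤ (2 + T * m) ^ 4 := by gcongr; linarith
      have h5 : (T * m) ^ 4 ≤ (2 + T * m) ^ 4 := by gcongr; linarith
      have h6 : (3 : ℝ) ^ 4 * (T * m) ^ 4 ≤ (2 + T * m) ^ 4 * (2 + T * m) ^ 4 := by gcongr
      have h7 : (2 + T * m) ^ 8 = (2 + T * m) ^ 4 * (2 + T * m) ^ 4 := by ring
      push_cast
      rw [h7]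
      linarith
    have hLlog : (L : ℝ) ≤ 17 * Real.log (2 + T * m) := by
      rw [hL]
      exact SkiRental.clog_two_le (by omega) hK8 hlog
    have htR : (t : ℝ) ≤ 12 * M + 14 * L + 102 + 82 * ((K + 1) * T) +
        N * (350 * ((K + 1) * T * T * T)) := by exact_mod_cast ht
    refine htR.trans (SkiRental.steps_le hT' hm1 hlog (Nat.cast_nonneg _) hMm (Nat.cast_nonneg _)
      hLlog ?_ ?_)
    · rw [hK]
      push_cast
      ring
    · rw [hN]
      push_cast
      ring
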